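/- Setting. For $\chi=0,1$ let $\mathcal U_\chi$ be a convex compact set of positive definite $d\times d$ matrices, $\Theta_*^{(\chi)}\succeq 0$ a matrix with $\Theta\preceq\Theta_*^{(\chi)}$ for all $\Theta\in\mathcal U_\chi$, $\delta_\chi\in[0,2]$ with $\|\Theta^{1/2}(\Theta_*^{(\chi)})^{-1/2}-I_d\|\le\delta_\chi$ (spectral norm) for all $\Theta\in\mathcal U_\chi$, $\beta_\chi\in[0,1)$, and $\mathcal Z_\chi$ a nonempty convex compact set of positive semidefinite $(d+1)\times(d+1)$ matrices $Z$ with $Z_{d+1,d+1}=1$. Put $$\mathcal H_\chi=\{(h,H):h\in\mathbb R^d,\ H=H^T\in\mathbb R^{d\times d},\ -\beta_\chi(\Theta_*^{(\chi)})^{-1}\preceq H\preceq\beta_\chi(\Theta_*^{(\chi)})^{-1}\}$$ and, omitting the index $\chi$ on $\Theta_*,\delta,\mathcal Z$ and writing $\hat H=\Theta_*^{1/2}H\Theta_*^{1/2}$ and $\|\cdot\|_F$ for the Frobenius norm, $$\Phi_{\chi}(h,H;\Theta)=-\tfrac12\log\det(I-\hat H)+\tfrac12\mathrm{Tr}([\Theta-\Theta_*]H)+\frac{\delta(2+\delta)}{2(1-\|\hat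 H\|)}\|\hat H\|_F^2+\tfrac12\max_{Z\in\mathcal Z}\mathrm{Tr}\Big(Z\Big(\begin{bmatrix}H&h\\h^T&0\end{bmatrix}+[H,h]^T[\Theta_*^{-1}-H]^{-1}[H,h]\Big)\Big).$$ Let $\mathcal G_\chi$ be the set of the Gaussian laws $N(u,\Theta)$ on $\mathbb R^d$ with $\Theta\in\mathcal U_\chi$ and $[u;1][u;1]^T\in\mathcal Z_\chi$. Let $$\mathcal{SV}=\min_{(h,H)\in\mathcal H_0\cap\mathcal H_1}\ \max_{\Theta_0\in\mathcal U_0,\Theta_1\in\mathcal U_1}\tfrac12\big[\Phi_{0}(-h,-H;\Theta_0)+\Phi_{1}(h,H;\Theta_1)\big],\qquad \varepsilon^*=\exp(\mathcal{SV}),$$ let $(h_*,H_*;\Theta_0^*,\Theta_1^*)$ be a saddle point of this problem, and let $$\phi^*(\xi)=\tfrac12\xi^TH_*\xi+h_*^T\xi+\tfrac12\big[\Phi_{0}(-h_*,-H_*;\Theta_0^*)-\Phi_{1}(h_*,H_*;\Theta_1^*)\big].$$ For a threshold $b$ and observations $\xi_1,\xi_2,\dots$ in $\mathbb R^d$ let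 $$T_2=T_2(b)=\inf\Big\{t\ge1:\ \max_{1\le k\le t}\sum_{i=k}^t(-\phi^*(\xi_i))\ge b\Big\}\in\{1,2,\dots\}\cup\{\infty\}.$$ For laws $\nu_0,\nu_1$ let $\mathbb E_\infty^{\nu_0}$ be the expectation when the $\xi_i$ are i.i.d. from $\nu_0$, and $\mathbb E_k^{\nu_0,\nu_1}$ the one when the $\xi_i$ are independent with $\xi_i\sim\nu_0$ for $i<k$ and $\xi_i\sim\nu_1$ for $i\ge k$; let $\mathcal F_{k}=\sigma(\xi_1,\dots,\xi_{k})$ and $$\mathrm{WDD}(T)=\sup_{k\ge1}\ \operatorname{ess\,sup}\ \mathbb E_k^{\nu_0,\nu_1}\big[(T-k+1)^+\mid\mathcal F_{k-1}\big].$$ Corollary. For all $\nu_0\in\mathcal G_0$ and $\nu_1\in\mathcal G_1$, $$\mathrm{WDD}(T_2(b))\le\frac{b}{1-\varepsilon^*}(1+o(1))\qquad(b\to\infty).$$ Moreover, there is a choice of thresholds $b=b(\gamma)$, which does not depend on $\nu_0$ and $\nu_1$, such that $\mathbb E_\infty^{\nu_0}[T_2(b(\gamma))]\ge\gamma$ for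 all $\nu_0\in\mathcal G_0$ and all $\gamma$, and such that for all $\nu_0\in\mathcal G_0$ and $\nu_1\in\mathcal G_1$ $$\mathrm{WDD}(T_2(b(\gamma)))\le\frac{\log\gamma}{1-\varepsilon^*}(1+o(1))\qquad(\gamma\to\infty).$$ (Always $\varepsilon^*\le1$; if $\varepsilon^*=1$, the right-hand sides are read as $+\infty$.) -/

import Mathlib

noncomputable section

namespace RobustCusum

open MeasureTheory ProbabilityTheory Matrix
open scoped MatrixOrder ENNReal

/-! ### Sequential change detection -/

section Detection

variable {X : Type*} [MeasurableSpace X]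

/-- Law of the observation sequence without a change: i.i.d. from `ν₀`.
The observation number `i + 1` is the coordinate `i`. -/
def lawNoChange (ν₀ : ProbabilityMeasure X) : Measure (ℕ → X) :=
  Measure.infinitePi fun _ : ℕ => (ν₀ : Measure X)

/-- Law of the observation sequence with change-point `k = m + 1`: independent observations, the
first `m` of them distributed as `ν₀` and all later ones as `ν₁`. -/
def lawChange (ν₀ ν₁ : ProbabilityMeasure X) (m : ℕ) : Measure (ℕ → X) :=
  Measure.infinitePi fun i : ℕ => ((if i < m then ν₀ else ν₁ : ProbabilityMeasure X) : Measure X)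

/-- The σ-algebra generated by the first `m` observations. -/
abbrev history (X : Type*) [MeasurableSpace X] (m : ℕ) : MeasurableSpace (ℕ → X) :=
  MeasureTheory.cylinderEvents {i : ℕ | i < m}

/-- Average run length: expectation of `T` when there is no change. -/
def ARL (ν₀ : ProbabilityMeasure X) (T : (ℕ → X) → ℕ∞) : ℝ≥0∞ :=
  ∫⁻ ω, (T ω : ℝ≥0∞) ∂(lawNoChange ν₀)

/-- Lorden's worst-case detection delay
`sup_{k ≥ 1} esssup 𝔼_k[(T - k + 1)⁺ | ℱ_{k-1}]`, written with `m = k - 1`. The subtraction in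
`[0, ∞]` is truncated, so that it is the positive part. -/
def WDD (ν₀ ν₁ : ProbabilityMeasure X) (T : (ℕ → X) → ℕ∞) : ℝ≥0∞ :=
  ⨆ m : ℕ, essSup
    (condLExp (history X m) (lawChange ν₀ ν₁ m) fun ω => (T ω : ℝ≥0∞) - (m : ℝ≥0∞))
    (lawChange ν₀ ν₁ m)

/-- CUSUM statistic at time `t = n + 1`: the maximum over the starting points of the sums of the
scores up to time `t`. -/
def cusumStat (s : ℕ → ℝ) (n : ℕ) : ℝ :=
  (Finset.range (n + 1)).sup' Finset.nonempty_range_add_one fun k => ∑ i ∈ Finset.Icc k n, s i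

/-- The first time `t = n + 1` at which the CUSUM statistic of the scores `score (ξ_i)` reaches the
level `b` (`⊤` if it never does). -/
def cusumTime (score : X → ℝ) (b : ℝ) (ω : ℕ → X) : ℕ∞ :=
  ⨅ (n : ℕ) (_ : b ≤ cusumStat (fun i => score (ω i)) n), ((n + 1 : ℕ) : ℕ∞)

end Detection

/-! ### The quadratic detector -/

/-- Spectral norm. -/
def specNorm {d : ℕ} (M : Matrix (Fin d) (Fin d) ℝ) : ℝ :=
  ‖Matrix.toEuclideanCLM (n := Fin d) (𝕜 := ℝ) M‖

/-- Squared Frobenius norm. -/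
def frobSq {d : ℕ} (M : Matrix (Fin d) (Fin d) ℝ) : ℝ := ∑ i, ∑ j, M i j ^ 2

/-- The column vector `[u; 1]`. -/
def lift1 {d : ℕ} (u : Fin d → ℝ) : Fin d ⊕ Unit → ℝ := Sum.elim u fun _ => 1

/-- The data `(𝒰, Θ_*, δ, β, 𝒵)` that describe one of the two uncertainty sets. -/
structure UncertaintyData (d : ℕ) where
  /-- the set of covariance matrices -/
  U : Set (Matrix (Fin d) (Fin d) ℝ)
  convex_U : Convex ℝ U
  isCompact_U : IsCompact U
  posDef_of_mem_U : ∀ Θ ∈ U, Θ.PosDef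
  /-- the upper bound `Θ_*` of the covariance matrices -/
  ΘStar : Matrix (Fin d) (Fin d) ℝ
  posSemidef_ΘStar : ΘStar.PosSemidef
  le_ΘStar : ∀ Θ ∈ U, (ΘStar - Θ).PosSemidef
  δ : ℝ
  δ_nonneg : 0 ≤ δ
  δ_le_two : δ ≤ 2
  le_δ : ∀ Θ ∈ U, specNorm (CFC.sqrt Θ * (CFC.sqrt ΘStar)⁻¹ - 1) ≤ δ
  β : ℝ
  β_nonneg : 0 ≤ β
  β_lt_one : β < 1
  /-- the set of the lifted mean vectors -/
  Z : Set (Matrix (Fin d ⊕ Unit) (Fin d ⊕ Unit) ℝ)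
  nonempty_Z : Z.Nonempty
  convex_Z : Convex ℝ Z
  isCompact_Z : IsCompact Z
  posSemidef_of_mem_Z : ∀ M ∈ Z, M.PosSemidef
  corner_of_mem_Z : ∀ M ∈ Z, M (Sum.inr ()) (Sum.inr ()) = 1

namespace UncertaintyData

variable {d : ℕ} (D : UncertaintyData d)

/-- Support function of `𝒵`. -/
def supportZ (Y : Matrix (Fin d ⊕ Unit) (Fin d ⊕ Unit) ℝ) : ℝ :=
  sSup ((fun M => (M * Y).trace) '' D.Z)

/-- The set `ℋ^β` of pairs `(h, H)` with `H` symmetric and `-β Θ_*⁻¹ ⪯ H ⪯ β Θ_*⁻¹`. -/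
def detectors : Set ((Fin d → ℝ) × Matrix (Fin d) (Fin d) ℝ) :=
  {p | p.2.IsSymm ∧ (p.2 - -(D.β • D.ΘStar⁻¹)).PosSemidef ∧ (D.β • D.ΘStar⁻¹ - p.2).PosSemidef}

/-- `Θ_*^{1/2} H Θ_*^{1/2}`. -/
def conj (H : Matrix (Fin d) (Fin d) ℝ) : Matrix (Fin d) (Fin d) ℝ :=
  CFC.sqrt D.ΘStar * H * CFC.sqrt D.ΘStar

/-- The matrix `[H, h; hᵀ, 0] + [H, h]ᵀ [Θ_*⁻¹ - H]⁻¹ [H, h]` of size `d + 1`. -/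
def liftedForm (h : Fin d → ℝ) (H : Matrix (Fin d) (Fin d) ℝ) :
    Matrix (Fin d ⊕ Unit) (Fin d ⊕ Unit) ℝ :=
  fromBlocks H (replicateCol Unit h) (replicateRow Unit h) 0 +
    (fromCols H (replicateCol Unit h))ᵀ * (D.ΘStar⁻¹ - H)⁻¹ * fromCols H (replicateCol Unit h)

/-- The function `Φ_𝒵(h, H; Θ)`. -/
def Phi (h : Fin d → ℝ) (H Θ : Matrix (Fin d) (Fin d) ℝ) : ℝ :=
  -(1 / 2) * Real.log (1 - D.conj H).det + 1 / 2 * ((Θ - D.ΘStar) * H).trace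
    + D.δ * (2 + D.δ) / (2 * (1 - specNorm (D.conj H))) * frobSq (D.conj H)
    + 1 / 2 * D.supportZ (D.liftedForm h H)

/-- The family `𝒢` of the Gaussian laws `N(u, Θ)` with `Θ ∈ 𝒰` and `[u; 1][u; 1]ᵀ ∈ 𝒵`. -/
def gaussians : Set (ProbabilityMeasure (EuclideanSpace ℝ (Fin d))) :=
  {ν | ∃ (u : Fin d → ℝ) (Θ : Matrix (Fin d) (Fin d) ℝ), Θ ∈ D.U ∧
    vecMulVec (lift1 u) (lift1 u) ∈ D.Z ∧
    (ν : Measure (EuclideanSpace ℝ (Fin d))) = multivariateGaussian (WithLp.toLp 2 u) Θ}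

end UncertaintyData

section SaddlePoint

variable {d : ℕ} (D₀ D₁ : UncertaintyData d)

/-- The objective `Φ(h, H; Θ₀, Θ₁)`, with `p = (h, H)` and `q = (Θ₀, Θ₁)`. -/
def objective (p : (Fin d → ℝ) × Matrix (Fin d) (Fin d) ℝ)
    (q : Matrix (Fin d) (Fin d) ℝ × Matrix (Fin d) (Fin d) ℝ) : ℝ :=
  1 / 2 * (D₀.Phi (-p.1) (-p.2) q.1 + D₁.Phi p.1 p.2 q.2)

/-- The saddle value: the minimum over `(h, H) ∈ ℋ₀ ∩ ℋ₁` of the maximum over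
`(Θ₀, Θ₁) ∈ 𝒰₀ × 𝒰₁` of the objective. -/
def saddleValue : ℝ :=
  sInf ((fun p => sSup (objective D₀ D₁ p '' (D₀.U ×ˢ D₁.U))) '' (D₀.detectors ∩ D₁.detectors))

/-- `ε* = exp(𝒮𝒱)`. -/
def epsStar : ℝ := Real.exp (saddleValue D₀ D₁)

/-- `p = (h, H)`, `q = (Θ₀, Θ₁)` is a saddle point (minimum in `p`, maximum in `q`). -/
def IsSaddle (p : (Fin d → ℝ) × Matrix (Fin d) (Fin d) ℝ)
    (q : Matrix (Fin d) (Fin d) ℝ × Matrix (Fin d) (Fin d) ℝ) : Prop :=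
  p ∈ D₀.detectors ∩ D₁.detectors ∧ q ∈ D₀.U ×ˢ D₁.U ∧
    IsSaddlePointOn (D₀.detectors ∩ D₁.detectors) (D₀.U ×ˢ D₁.U) (objective D₀ D₁) p q

/-- The quadratic detector `φ*` given by `p = (h, H)` and `q = (Θ₀, Θ₁)`. -/
def detector (p : (Fin d → ℝ) × Matrix (Fin d) (Fin d) ℝ)
    (q : Matrix (Fin d) (Fin d) ℝ × Matrix (Fin d) (Fin d) ℝ) (ξ : EuclideanSpace ℝ (Fin d)) : ℝ :=
  1 / 2 * (ξ.ofLp ⬝ᵥ p.2 *ᵥ ξ.ofLp) + p.1 ⬝ᵥ ξ.ofLp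
    + 1 / 2 * (D₀.Phi (-p.1) (-p.2) q.1 - D₁.Phi p.1 p.2 q.2)

/-- The detection procedure `T₂` with threshold `b`. -/
def T2 (p : (Fin d → ℝ) × Matrix (Fin d) (Fin d) ℝ)
    (q : Matrix (Fin d) (Fin d) ℝ × Matrix (Fin d) (Fin d) ℝ) (b : ℝ) :
    (ℕ → EuclideanSpace ℝ (Fin d)) → ℕ∞ :=
  cusumTime (fun ξ => -detector D₀ D₁ p q ξ) b

end SaddlePoint

end RobustCusum

end

namespace RobustCusum

open MeasureTheory ProbabilityTheory Matrix Filter Topology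
open scoped MatrixOrder ENNReal

/-! ### Independence of past and next observation, and the events of no alarm -/

section Detection

variable {X : Type*} [MeasurableSpace X]

/-! Let `s = -φ*` be the score. Everything rests on two exponential moments: `E exp(s) ≤ 1` under
every law of `𝒢₀` and `E exp(-s) ≤ ε*` under every law of `𝒢₁`.

Run length: the Shiryaev–Roberts statistic `R (n+1) = (1 + R n) exp(s n)` dominates the exponential
of the CUSUM statistic, and `R n - n` is a supermartingale under `ν₀`. Stopping at the alarm gives
`exp b ≤ E T` (`exp_le_ARL_cusumTime`), so the threshold `log γ` suffices.

Delay: after the change, CUSUM dominates the walk restarted at the change-point, whatever the past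
was. Since `x ≥ 1 - exp(-x)`, the mean step is at least `1 - ε*`. A Wald argument for the walk with
steps truncated at `c` bounds the delay by `(b + c) / (1 - ε* - exp(-c))` (`WDD_cusumTime_le`), and
`c = √b` yields the asymptotics.

Moments: for a Gaussian law the exponential moment of a quadratic function is explicit. `Φ` bounds
its logarithm (`lintegral_exp_quadratic_le`): `Θ` is compared with `Θ_*` through the concavity of
`log det` and a variational formula for the inverse, and the mean is absorbed by the support
function of `𝒵`. The saddle inequalities make the bound uniform over both families, and comparison
with the zero detector gives a nonpositive exponent. -/

theorem history_mono {m n : ℕ} (h : m ≤ n) : history X m ≤ history X n :=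
  cylinderEvents_mono fun _ hi => lt_of_lt_of_le hi h

theorem history_le (m : ℕ) : history X m ≤ MeasurableSpace.pi := cylinderEvents_le_pi

theorem measurable_eval_history {i m : ℕ} (h : i < m) :
    Measurable[history X m] fun ω : ℕ → X => ω i :=
  measurable_cylinderEvent_apply h

/-- A function of the past and the next observation are independent. -/
theorem lintegral_history_mul (ν : ℕ → Measure X) [∀ i, IsProbabilityMeasure (ν i)] (k : ℕ)
    {g : (ℕ → X) → ℝ≥0∞} (hg : Measurable[history X k] g) {f : X → ℝ≥0∞} (hf : Measurable f) :
    ∫⁻ ω, g ω * f (ω k) ∂(Measure.infinitePi ν) =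
      (∫⁻ ω, g ω ∂(Measure.infinitePi ν)) * ∫⁻ x, f x ∂(ν k) := by
  have hind : iIndep (fun i : ℕ => MeasurableSpace.comap (fun ω : ℕ → X => ω i) inferInstance)
      (Measure.infinitePi ν) :=
    iIndepFun_infinitePi (P := ν) (X := fun _ x => x) fun _ => measurable_id
  have hI := indep_iSup_of_disjoint (S := {i | i < k}) (T := {k})
    (fun i => (measurable_pi_apply i).comap_le) hind (by simp)
  rw [← Measure.infinitePi_map_eval ν k, lintegral_map hf (measurable_pi_apply k)]
  refine lintegral_mul_eq_lintegral_mul_lintegral_of_independent_measurableSpace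
    (history_le k) (cylinderEvents_le_pi (Δ := {k})) hI hg ?_
  exact hf.comp (measurable_cylinderEvent_apply (Set.mem_singleton k))

theorem measurable_cusumStat_history {score : X → ℝ} (hs : Measurable score) (n : ℕ) :
    Measurable[history X (n + 1)] fun ω : ℕ → X => cusumStat (fun i => score (ω i)) n := by
  unfold cusumStat
  refine @Finset.measurable_range_sup'' ℝ _ (ℕ → X) (history X (n + 1)) _ _ _ _ fun k _ =>
    Finset.measurable_sum _ fun i hi => ?_
  exact hs.comp (measurable_eval_history (Nat.lt_succ_of_le (Finset.mem_Icc.1 hi).2))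

/-- The event that no alarm is raised by the first `n` observations. -/
def noAlarm (score : X → ℝ) (b : ℝ) (n : ℕ) : Set (ℕ → X) :=
  {ω | ∀ j < n, cusumStat (fun i => score (ω i)) j < b}

theorem measurableSet_noAlarm {score : X → ℝ} (hs : Measurable score) (b : ℝ) (n : ℕ) :
    MeasurableSet[history X n] (noAlarm score b n) := by
  simp only [noAlarm, Set.ofPred_forall]
  refine MeasurableSet.iInter fun j => MeasurableSet.iInter fun hj => ?_
  exact ((measurable_cusumStat_history hs j).mono (history_mono hj) le_rfl) measurableSet_Iio

theorem noAlarm_succ_subset {X : Type*} (score : X → ℝ) (b : ℝ) (n : ℕ) :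
    noAlarm score b (n + 1) ⊆ noAlarm score b n := fun _ h j hj => h j (hj.trans n.lt_succ_self)

/-- The statistic of index `j` can raise an alarm only at time `j + 1`; hence the event `T > n`
involves the indices `j < n`, that is, the first `n` observations. -/
theorem lt_cusumTime_iff {X : Type*} {score : X → ℝ} {b : ℝ} {n : ℕ} {ω : ℕ → X} :
    (n : ℕ∞) < cusumTime score b ω ↔ ω ∈ noAlarm score b n := by
  rw [← ENat.add_one_le_iff (ENat.natCast_ne_top n)]
  simp only [cusumTime, le_iInf_iff, noAlarm, Set.mem_ofPred_eq]
  refine ⟨fun h j hj => ?_, fun h j hj => ?_⟩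
  · by_contra! hb
    have := h j hb
    norm_cast at this
    omega
  · by_contra! hn
    norm_cast at hn
    exact absurd hj (not_le.2 (h j (by omega)))

/-- The tail-sum formula in `[0, ∞]`, for the excess over `m`. -/
theorem toENNReal_tsub_eq_tsum (T : ℕ∞) (m : ℕ) :
    (T : ℝ≥0∞) - (m : ℝ≥0∞) = ∑' n : ℕ, if ((m + n : ℕ) : ℕ∞) < T then 1 else 0 := by
  induction T using ENat.recTopCoe with
  | top => simp
  | coe t =>
    rw [tsum_eq_sum (s := Finset.range (t - m))]
    · have : ∀ n ∈ Finset.range (t - m),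
          (if ((m + n : ℕ) : ℕ∞) < (t : ℕ∞) then (1 : ℝ≥0∞) else 0) = 1 := by
        intro n hn
        rw [if_pos]
        rw [Finset.mem_range] at hn
        exact_mod_cast (by omega : m + n < t)
      rw [Finset.sum_congr rfl this]
      simp
    · intro n hn
      rw [if_neg]
      rw [Finset.mem_range] at hn
      exact_mod_cast (by omega : ¬ (m + n < t))

theorem lintegral_indicator_one_mul {Ω : Type*} [MeasurableSpace Ω] (μ : Measure Ω) {A : Set Ω}
    (hA : MeasurableSet A) (f : Ω → ℝ≥0∞) :
    ∫⁻ ω, A.indicator 1 ω * f ω ∂μ = ∫⁻ ω in A, f ω ∂μ := by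
  rw [← lintegral_indicator hA]
  refine lintegral_congr fun ω => ?_
  by_cases h : ω ∈ A <;> simp [h]

theorem setLIntegral_history (ν : ℕ → Measure X) [∀ i, IsProbabilityMeasure (ν i)] (k : ℕ)
    {A : Set (ℕ → X)} (hA : MeasurableSet[history X k] A)
    {g : (ℕ → X) → ℝ≥0∞} (hg : Measurable[history X k] g) {f : X → ℝ≥0∞} (hf : Measurable f) :
    ∫⁻ ω in A, g ω * f (ω k) ∂(Measure.infinitePi ν) =
      (∫⁻ ω in A, g ω ∂(Measure.infinitePi ν)) * ∫⁻ x, f x ∂(ν k) := by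
  rw [← lintegral_indicator_one_mul _ (history_le k _ hA),
    ← lintegral_indicator_one_mul _ (history_le k _ hA)]
  simp_rw [← mul_assoc]
  refine lintegral_history_mul ν k (Measurable.mul ?_ hg) hf
  exact (measurable_indicator_const_iff (m := history X k) (1 : ℝ≥0∞)).2 hA

/-! ### Average run length -/

/-- The Shiryaev–Roberts statistic of the scores `s` after `n` observations. -/
noncomputable def shiryaevRoberts (s : ℕ → ℝ) : ℕ → ℝ
  | 0 => 0
  | n + 1 => (1 + shiryaevRoberts s n) * Real.exp (s n)

/-- The recursion gives the supermartingale property; the sum over all starting points shows that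
each exponentiated CUSUM candidate is one of its nonnegative summands. -/
theorem shiryaevRoberts_eq (s : ℕ → ℝ) (n : ℕ) :
    shiryaevRoberts s n = ∑ k ∈ Finset.range n, Real.exp (∑ i ∈ Finset.Ico k n, s i) := by
  induction n with
  | zero => simp [shiryaevRoberts]
  | succ n ih =>
    rw [shiryaevRoberts, ih, Finset.sum_range_succ, add_mul, Finset.sum_mul, one_mul, add_comm]
    congr 1
    · refine Finset.sum_congr rfl fun k hk => ?_
      rw [Finset.sum_Ico_succ_top (Finset.mem_range.1 hk).le, Real.exp_add]
    · simp

theorem shiryaevRoberts_nonneg (s : ℕ → ℝ) (n : ℕ) : 0 ≤ shiryaevRoberts s n := by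
  rw [shiryaevRoberts_eq]
  exact Finset.sum_nonneg fun _ _ => (Real.exp_pos _).le

theorem exp_cusumStat_le (s : ℕ → ℝ) (n : ℕ) :
    Real.exp (cusumStat s n) ≤ shiryaevRoberts s (n + 1) := by
  obtain ⟨k, hk, hkeq⟩ := Finset.exists_mem_eq_sup' (Finset.nonempty_range_add_one (n := n))
    fun k => ∑ i ∈ Finset.Icc k n, s i
  rw [cusumStat, hkeq, shiryaevRoberts_eq]
  exact Finset.single_le_sum (f := fun k => Real.exp (∑ i ∈ Finset.Ico k (n + 1), s i))
    (fun _ _ => (Real.exp_pos _).le) hk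

theorem measurable_shiryaevRoberts_history {score : X → ℝ} (hs : Measurable score) (n : ℕ) :
    Measurable[history X n] fun ω : ℕ → X => shiryaevRoberts (fun i => score (ω i)) n := by
  simp_rw [shiryaevRoberts_eq]
  refine Finset.measurable_sum _ fun k _ => ?_
  refine Real.measurable_exp.comp (Finset.measurable_sum _ fun i hi => ?_)
  exact hs.comp (measurable_eval_history (Finset.mem_Ico.1 hi).2)

instance (ν₀ : ProbabilityMeasure X) : IsProbabilityMeasure (lawNoChange ν₀) := by
  rw [lawNoChange]; infer_instance

instance (ν₀ ν₁ : ProbabilityMeasure X) (m : ℕ) : IsProbabilityMeasure (lawChange ν₀ ν₁ m) := by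
  rw [lawChange]; infer_instance

theorem ARL_cusumTime_eq_tsum (ν₀ : ProbabilityMeasure X) {score : X → ℝ} (hs : Measurable score)
    (b : ℝ) :
    ARL ν₀ (cusumTime score b) = ∑' n, lawNoChange ν₀ (noAlarm score b n) := by
  have hm : ∀ n, MeasurableSet (noAlarm score b n) := fun n =>
    history_le n _ (measurableSet_noAlarm hs b n)
  calc ARL ν₀ (cusumTime score b)
      = ∫⁻ ω, ∑' n, (noAlarm score b n).indicator 1 ω ∂(lawNoChange ν₀) := by
        refine lintegral_congr fun ω => ?_
        have := toENNReal_tsub_eq_tsum (cusumTime score b ω) 0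
        simp only [CharP.cast_eq_zero, tsub_zero, zero_add] at this
        rw [this]
        refine tsum_congr fun n => ?_
        by_cases h : ω ∈ noAlarm score b n
        · rw [if_pos (lt_cusumTime_iff.2 h), Set.indicator_of_mem h, Pi.one_apply]
        · rw [if_neg (mt lt_cusumTime_iff.1 h), Set.indicator_of_notMem h]
    _ = _ := by
        rw [lintegral_tsum fun n => (measurable_one.indicator (hm n)).aemeasurable]
        exact tsum_congr fun n => lintegral_indicator_one (hm n)

/-- Optional stopping for `R n - n`, written without subtraction: the right side is `E min(T, n)`,
and the left side is a lower bound for the mean of `R` at time `min(T, n)`, because `R ≥ exp b` at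
an alarm. -/
theorem setLIntegral_shiryaevRoberts_add_le (ν₀ : ProbabilityMeasure X) {score : X → ℝ}
    (hs : Measurable score) (hexp : ∫⁻ x, ENNReal.ofReal (Real.exp (score x)) ∂(ν₀ : Measure X) ≤ 1)
    (b : ℝ) (n : ℕ) :
    ∫⁻ ω in noAlarm score b n, ENNReal.ofReal (shiryaevRoberts (fun i => score (ω i)) n)
        ∂(lawNoChange ν₀) +
      ENNReal.ofReal (Real.exp b) * lawNoChange ν₀ (noAlarm score b n)ᶜ ≤
      ∑ j ∈ Finset.range n, lawNoChange ν₀ (noAlarm score b j) := by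
  have hm : ∀ n, MeasurableSet (noAlarm score b n) := fun n =>
    history_le n _ (measurableSet_noAlarm hs b n)
  induction n with
  | zero => simp [noAlarm, shiryaevRoberts]
  | succ n ih =>
    set μ := lawNoChange ν₀ with hμ
    set R : ℕ → (ℕ → X) → ℝ≥0∞ := fun n ω =>
      ENNReal.ofReal (shiryaevRoberts (fun i => score (ω i)) n) with hR
    set G := noAlarm score b n
    set G' := noAlarm score b (n + 1)
    have hsub : G' ⊆ G := noAlarm_succ_subset score b n
    have hcompl : μ G'ᶜ ≤ μ (G \ G') + μ Gᶜ := by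
      refine (measure_mono fun ω hω => ?_).trans (measure_union_le _ _)
      by_cases h : ω ∈ G
      · exact Or.inl ⟨h, hω⟩
      · exact Or.inr h
    -- On `G \ G'` the first alarm is raised by the statistic of index `n`, whose exponential is at
    -- most `R (n + 1)`.
    have hcross : ENNReal.ofReal (Real.exp b) * μ (G \ G') ≤ ∫⁻ ω in G \ G', R (n + 1) ω ∂μ := by
      rw [← setLIntegral_const]
      refine setLIntegral_mono' ((hm n).diff (hm (n + 1))) fun ω hω => ?_
      refine ENNReal.ofReal_le_ofReal (le_trans (Real.exp_le_exp.2 ?_) (exp_cusumStat_le _ n))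
      by_contra! hlt
      refine hω.2 fun j hj => ?_
      rcases Nat.lt_succ_iff_lt_or_eq.1 hj with h | rfl
      · exact hω.1 j h
      · exact hlt
    have hstep : ∫⁻ ω in G, R (n + 1) ω ∂μ ≤ μ G + ∫⁻ ω in G, R n ω ∂μ := by
      have hRm : Measurable[history X n] (R n) :=
        (measurable_shiryaevRoberts_history hs n).ennreal_ofReal
      calc ∫⁻ ω in G, R (n + 1) ω ∂μ
          = ∫⁻ ω in G, (1 + R n ω) * ENNReal.ofReal (Real.exp (score (ω n))) ∂μ := by
            refine lintegral_congr fun ω => ?_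
            simp only [hR, shiryaevRoberts]
            rw [ENNReal.ofReal_mul (by linarith [shiryaevRoberts_nonneg (fun i => score (ω i)) n]),
              ENNReal.ofReal_add zero_le_one (shiryaevRoberts_nonneg _ _), ENNReal.ofReal_one]
        _ = (∫⁻ ω in G, (1 + R n ω) ∂μ) *
              ∫⁻ x, ENNReal.ofReal (Real.exp (score x)) ∂(ν₀ : Measure X) :=
            setLIntegral_history _ n (measurableSet_noAlarm hs b n) (measurable_const.add hRm)
              (Real.measurable_exp.comp hs).ennreal_ofReal
        _ ≤ ∫⁻ ω in G, (1 + R n ω) ∂μ := mul_le_of_le_one_right' hexp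
        _ = μ G + ∫⁻ ω in G, R n ω ∂μ := by
            rw [lintegral_add_left measurable_const, setLIntegral_one]
    calc ∫⁻ ω in G', R (n + 1) ω ∂μ + ENNReal.ofReal (Real.exp b) * μ G'ᶜ
        ≤ ∫⁻ ω in G', R (n + 1) ω ∂μ +
            (∫⁻ ω in G \ G', R (n + 1) ω ∂μ + ENNReal.ofReal (Real.exp b) * μ Gᶜ) := by
          gcongr
          refine (mul_le_mul_right hcompl _).trans ?_
          rw [mul_add]
          gcongr
      _ = ∫⁻ ω in G, R (n + 1) ω ∂μ + ENNReal.ofReal (Real.exp b) * μ Gᶜ := by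
          rw [← add_assoc, ← lintegral_union ((hm n).diff (hm (n + 1))) Set.disjoint_sdiff_right,
            Set.union_sdiff_cancel hsub]
      _ ≤ μ G + (∫⁻ ω in G, R n ω ∂μ + ENNReal.ofReal (Real.exp b) * μ Gᶜ) := by
          rw [← add_assoc]
          gcongr
      _ ≤ _ := by
          rw [Finset.sum_range_succ, add_comm]
          gcongr

/-- A CUSUM procedure whose score has exponential moment at most one under `ν₀` has average run
length at least `exp b`. -/
theorem exp_le_ARL_cusumTime (ν₀ : ProbabilityMeasure X) {score : X → ℝ} (hs : Measurable score)
    (hexp : ∫⁻ x, ENNReal.ofReal (Real.exp (score x)) ∂(ν₀ : Measure X) ≤ 1) (b : ℝ) :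
    ENNReal.ofReal (Real.exp b) ≤ ARL ν₀ (cusumTime score b) := by
  have hm : ∀ n, MeasurableSet (noAlarm score b n) := fun n =>
    history_le n _ (measurableSet_noAlarm hs b n)
  rw [ARL_cusumTime_eq_tsum ν₀ hs]
  set s := ∑' n, lawNoChange ν₀ (noAlarm score b n) with hsdef
  -- If the expectation is finite, then `P(T > n) → 0`, so `exp b * P(T ≤ n)` tends to `exp b` while
  -- staying below `E T`.
  by_cases htop : s = ∞
  · simp [htop]
  have hlim : Tendsto (fun n => lawNoChange ν₀ (noAlarm score b n)) atTop (𝓝 0) :=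
    ENNReal.tendsto_atTop_zero_of_tsum_ne_top htop
  have hlim' : Tendsto (fun n => ENNReal.ofReal (Real.exp b) *
      (1 - lawNoChange ν₀ (noAlarm score b n))) atTop (𝓝 (ENNReal.ofReal (Real.exp b) * (1 - 0))) :=
    ENNReal.Tendsto.const_mul
      (ENNReal.Tendsto.sub tendsto_const_nhds hlim (Or.inl ENNReal.one_ne_top))
      (Or.inr ENNReal.ofReal_ne_top)
  rw [tsub_zero, mul_one] at hlim'
  refine le_of_tendsto' hlim' fun n => ?_
  rw [← prob_compl_eq_one_sub (hm n)]
  exact (le_add_self.trans (setLIntegral_shiryaevRoberts_add_le ν₀ hs hexp b n)).trans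
    (ENNReal.sum_le_tsum _)

/-! ### Worst-case detection delay -/

/-- The event that the truncated random walk started after observation `m` stays below `b` for `n`
steps. -/
def walkBelow (score : X → ℝ) (b c : ℝ) (m n : ℕ) : Set (ℕ → X) :=
  {ω | ∀ j ≤ n, ∑ i ∈ Finset.range j, min (score (ω (m + i))) c < b}

theorem measurableSet_walkBelow {score : X → ℝ} (hs : Measurable score) (b c : ℝ) (m n : ℕ) :
    MeasurableSet[history X (m + n)] (walkBelow score b c m n) := by
  simp only [walkBelow, Set.ofPred_forall]
  refine MeasurableSet.iInter fun j => MeasurableSet.iInter fun hj => ?_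
  have : Measurable[history X (m + n)]
      fun ω : ℕ → X => ∑ i ∈ Finset.range j, min (score (ω (m + i))) c := by
    refine Finset.measurable_sum _ fun i hi => ?_
    refine (hs.comp (measurable_eval_history ?_)).min measurable_const
    have := Finset.mem_range.1 hi
    omega
  exact this measurableSet_Iio

/-- The CUSUM statistic maximises over starting points, so it dominates the walk started after
observation `m`; truncating the steps only lowers that walk. Positivity of `b` covers the empty sum.
-/
theorem noAlarm_subset_walkBelow {X : Type*} (score : X → ℝ) {b : ℝ} (hb : 0 < b) (c : ℝ) (m n : ℕ) :
    noAlarm score b (m + n) ⊆ walkBelow score b c m n := by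
  intro ω hω j hj
  rcases Nat.eq_zero_or_pos j with rfl | hpos
  · simpa using hb
  have h1 : ∑ i ∈ Finset.Icc m (m + j - 1), score (ω i) ≤
      cusumStat (fun i => score (ω i)) (m + j - 1) :=
    Finset.le_sup' (fun k => ∑ i ∈ Finset.Icc k (m + j - 1), score (ω i))
      (Finset.mem_range.2 (by omega))
  have h2 : Finset.Icc m (m + j - 1) = Finset.Ico m (m + j) := by
    ext i; simp only [Finset.mem_Icc, Finset.mem_Ico]; omega
  rw [h2, Finset.sum_Ico_eq_sum_range, Nat.add_sub_cancel_left] at h1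
  refine (Finset.sum_le_sum fun i _ => min_le_left _ _).trans_lt (h1.trans_lt ?_)
  exact hω _ (by omega)

/-- This turns a bound on `E exp(-x)` into a lower bound for the drift of the truncated step, with
no integrability of `x` itself. -/
theorem one_sub_exp_sub_exp_le_min (x c : ℝ) : 1 - Real.exp (-c) - Real.exp (-x) ≤ min x c := by
  have h1 := Real.add_one_le_exp (-x)
  have h2 := Real.add_one_le_exp (-c)
  have := Real.exp_pos (-x)
  have := Real.exp_pos (-c)
  exact le_min (by linarith) (by linarith)

/-- Pathwise form of Wald's identity: before its exit the walk is below `b`, the exit step adds at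
most `c`, and afterwards all indicators vanish. -/
theorem sum_indicator_walkBelow_le {X : Type*} (score : X → ℝ) {b c : ℝ} (hb : 0 < b) (hc : 0 ≤ c) (m K : ℕ)
    (ω : ℕ → X) :
    ∑ n ∈ Finset.range K, (walkBelow score b c m n).indicator
      (fun ω => 1 - Real.exp (-c) - Real.exp (-score (ω (m + n)))) ω ≤ b + c := by
  -- The induction also has to carry the comparison with the walk itself, valid as long as the walk
  -- has not left; it is what bounds the sum at the exit step.
  suffices h : (ω ∈ walkBelow score b c m K →
      ∑ n ∈ Finset.range K, (walkBelow score b c m n).indicator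
        (fun ω => 1 - Real.exp (-c) - Real.exp (-score (ω (m + n)))) ω ≤
        ∑ i ∈ Finset.range K, min (score (ω (m + i))) c) ∧
      ∑ n ∈ Finset.range K, (walkBelow score b c m n).indicator
        (fun ω => 1 - Real.exp (-c) - Real.exp (-score (ω (m + n)))) ω ≤ b + c from h.2
  induction K with
  | zero => simp; positivity
  | succ K ih =>
    have hmin := one_sub_exp_sub_exp_le_min (score (ω (m + K))) c
    rw [Finset.sum_range_succ, Finset.sum_range_succ]
    by_cases hK : ω ∈ walkBelow score b c m K
    · rw [Set.indicator_of_mem hK]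
      have h1 := ih.1 hK
      have h2 := hK K le_rfl
      refine ⟨fun _ => by linarith, ?_⟩
      linarith [min_le_right (score (ω (m + K))) c]
    · rw [Set.indicator_of_notMem hK, add_zero]
      exact ⟨fun h => absurd (fun j hj => h j (hj.trans K.le_succ)) hK, ih.2⟩

/-- Conditional expectations are bounded by a constant that bounds the averages over the events of
the conditioning σ-algebra. -/
theorem essSup_condLExp_le {Ω : Type*} {m₀ m : MeasurableSpace Ω} (hm : m ≤ m₀) (μ : Measure[m₀] Ω)
    [IsFiniteMeasure μ] (f : Ω → ℝ≥0∞) (C : ℝ≥0∞)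
    (h : ∀ A, MeasurableSet[m] A → ∫⁻ ω in A, f ω ∂μ ≤ C * μ A) :
    essSup (condLExp m μ f) μ ≤ C := by
  refine essSup_le_of_ae_le _ (ae_le_of_ae_le_trim (hm := hm) ?_)
  refine ae_le_of_forall_setLIntegral_le_of_sigmaFinite (measurable_condLExp _ _ _)
    fun s hs _ => ?_
  rw [setLIntegral_condLExp_trim hm _ _ hs, setLIntegral_const, trim_measurableSet_eq hm hs]
  exact h s hs

/-- The pathwise bound is integrated over the past event `A`. Since `A ∩ B n` depends on the first
`m + n` observations only, the next one is an independent draw from `ν₁`. With `a` the sum of the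
probabilities, this gives `(1 - exp(-c)) a ≤ (b + c) P(A) + ε a`, which is solved for `a`. -/
theorem sum_lawChange_inter_walkBelow_le (ν₀ ν₁ : ProbabilityMeasure X) {score : X → ℝ}
    (hs : Measurable score) {ε : ℝ} (hε : 0 ≤ ε)
    (hexp : ∫⁻ x, ENNReal.ofReal (Real.exp (-score x)) ∂(ν₁ : Measure X) ≤ ENNReal.ofReal ε)
    {b c : ℝ} (hb : 0 < b) (hc : 0 ≤ c) (hlt : 0 < 1 - ε - Real.exp (-c)) (m K : ℕ)
    {A : Set (ℕ → X)} (hA : MeasurableSet[history X m] A) :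
    ∑ n ∈ Finset.range K, lawChange ν₀ ν₁ m (A ∩ walkBelow score b c m n) ≤
      ENNReal.ofReal ((b + c) / (1 - ε - Real.exp (-c))) * lawChange ν₀ ν₁ m A := by
  set μ := lawChange ν₀ ν₁ m with hμ
  set B := walkBelow score b c m
  have hAm : MeasurableSet A := history_le m _ hA
  have hABh : ∀ n, MeasurableSet[history X (m + n)] (A ∩ B n) := fun n =>
    (history_mono (Nat.le_add_right m n) _ hA).inter (measurableSet_walkBelow hs b c m n)
  have hBm : ∀ n, MeasurableSet (B n) := fun n =>
    history_le _ _ (measurableSet_walkBelow hs b c m n)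
  have hec : 0 ≤ 1 - Real.exp (-c) := by linarith
  -- The negative terms are moved to the right, so that both sides live in `[0, ∞]`.
  have hpt : ∀ ω, ∑ n ∈ Finset.range K,
      (B n).indicator (fun _ => ENNReal.ofReal (1 - Real.exp (-c))) ω ≤
      ENNReal.ofReal (b + c) + ∑ n ∈ Finset.range K,
        (B n).indicator (fun ω => ENNReal.ofReal (Real.exp (-score (ω (m + n))))) ω := by
    intro ω
    have key := sum_indicator_walkBelow_le score hb hc m K ω
    have e1 : ∀ n, (B n).indicator (fun _ => ENNReal.ofReal (1 - Real.exp (-c))) ω =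
        ENNReal.ofReal ((B n).indicator (fun _ => 1 - Real.exp (-c)) ω) := fun n => by
      by_cases h : ω ∈ B n <;> simp [h]
    have e2 : ∀ n, (B n).indicator (fun ω => ENNReal.ofReal (Real.exp (-score (ω (m + n))))) ω =
        ENNReal.ofReal ((B n).indicator (fun ω => Real.exp (-score (ω (m + n)))) ω) := fun n => by
      by_cases h : ω ∈ B n <;> simp [h]
    have n1 : ∀ n, 0 ≤ (B n).indicator (fun _ => 1 - Real.exp (-c)) ω := fun n =>
      Set.indicator_nonneg (fun _ _ => hec) _
    have n2 : ∀ n, 0 ≤ (B n).indicator (fun ω => Real.exp (-score (ω (m + n)))) ω := fun n =>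
      Set.indicator_nonneg (fun _ _ => (Real.exp_pos _).le) _
    simp_rw [e1, e2]
    rw [← ENNReal.ofReal_sum_of_nonneg fun n _ => n1 n,
      ← ENNReal.ofReal_sum_of_nonneg fun n _ => n2 n,
      ← ENNReal.ofReal_add (by linarith) (Finset.sum_nonneg fun n _ => n2 n)]
    refine ENNReal.ofReal_le_ofReal ?_
    have e3 : ∀ n, (B n).indicator
        (fun ω => 1 - Real.exp (-c) - Real.exp (-score (ω (m + n)))) ω =
        (B n).indicator (fun _ => 1 - Real.exp (-c)) ω -
          (B n).indicator (fun ω => Real.exp (-score (ω (m + n)))) ω := fun n => by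
      by_cases h : ω ∈ B n <;> simp [h]
    rw [← sub_le_iff_le_add, ← Finset.sum_sub_distrib]
    simpa only [← e3] using key
  have hint : ∀ n, ∫⁻ ω in A ∩ B n, ENNReal.ofReal (Real.exp (-score (ω (m + n)))) ∂μ ≤
      ENNReal.ofReal ε * μ (A ∩ B n) := by
    intro n
    have := setLIntegral_history
      (fun i : ℕ => ((if i < m then ν₀ else ν₁ : ProbabilityMeasure X) : Measure X)) (m + n)
      (hABh n) (g := fun _ => 1) measurable_const
      (f := fun x => ENNReal.ofReal (Real.exp (-score x)))
      (Real.measurable_exp.comp hs.neg).ennreal_ofReal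
    simp only [one_mul, setLIntegral_one, if_neg (Nat.not_lt.2 (Nat.le_add_right m n))] at this
    rw [hμ, lawChange, this, mul_comm]
    gcongr
  set a := ∑ n ∈ Finset.range K, μ (A ∩ B n) with ha
  have hmain : ENNReal.ofReal (1 - Real.exp (-c)) * a ≤
      ENNReal.ofReal (b + c) * μ A + ENNReal.ofReal ε * a := by
    calc ENNReal.ofReal (1 - Real.exp (-c)) * a
        = ∫⁻ ω in A, ∑ n ∈ Finset.range K,
            (B n).indicator (fun _ => ENNReal.ofReal (1 - Real.exp (-c))) ω ∂μ := by
          rw [lintegral_finsetSum _ fun n _ => measurable_const.indicator (hBm n), ha,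
            Finset.mul_sum]
          refine Finset.sum_congr rfl fun n _ => ?_
          rw [lintegral_indicator (hBm n), setLIntegral_const, Measure.restrict_apply (hBm n),
            Set.inter_comm]
      _ ≤ ∫⁻ ω in A, (ENNReal.ofReal (b + c) + ∑ n ∈ Finset.range K,
            (B n).indicator (fun ω => ENNReal.ofReal (Real.exp (-score (ω (m + n))))) ω) ∂μ :=
          lintegral_mono hpt
      _ = ENNReal.ofReal (b + c) * μ A + ∑ n ∈ Finset.range K,
            ∫⁻ ω in A ∩ B n, ENNReal.ofReal (Real.exp (-score (ω (m + n)))) ∂μ := by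
          rw [lintegral_add_left measurable_const, setLIntegral_const, lintegral_finsetSum]
          · congr 1
            refine Finset.sum_congr rfl fun n _ => ?_
            rw [lintegral_indicator (hBm n), Measure.restrict_restrict (hBm n), Set.inter_comm]
          · intro n _
            refine Measurable.indicator ?_ (hBm n)
            exact (Real.measurable_exp.comp (hs.comp (measurable_pi_apply _)).neg).ennreal_ofReal
      _ ≤ _ := by
          rw [ha, Finset.mul_sum]
          gcongr with n
          exact hint n
  -- Finiteness of the partial sum is what allows `ε a` to be subtracted, after passing to real
  -- numbers.
  have hafin : a ≠ ∞ := ENNReal.sum_ne_top.2 fun n _ => measure_ne_top _ _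
  have hAfin : μ A ≠ ∞ := measure_ne_top _ _
  lift a to NNReal using hafin with a'
  set r := (μ A).toReal with hr
  have hr0 : 0 ≤ r := ENNReal.toReal_nonneg
  rw [← ENNReal.ofReal_toReal hAfin, ← hr, ← ENNReal.ofReal_coe_nnreal] at hmain ⊢
  rw [← ENNReal.ofReal_mul hec, ← ENNReal.ofReal_mul (by linarith), ← ENNReal.ofReal_mul hε,
    ← ENNReal.ofReal_add (by positivity) (by positivity),
    ENNReal.ofReal_le_ofReal_iff (by positivity)] at hmain
  rw [← ENNReal.ofReal_mul (by positivity)]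
  refine ENNReal.ofReal_le_ofReal ?_
  rw [div_mul_eq_mul_div, le_div_iff₀ hlt]
  nlinarith

/-- The tail events of the delay lie in the events `walkBelow`; the resulting bound depends neither
on `m` nor on the past event, so it survives the essential supremum and the supremum over `m`. -/
theorem WDD_cusumTime_le (ν₀ ν₁ : ProbabilityMeasure X) {score : X → ℝ}
    (hs : Measurable score) {ε : ℝ} (hε : 0 ≤ ε)
    (hexp : ∫⁻ x, ENNReal.ofReal (Real.exp (-score x)) ∂(ν₁ : Measure X) ≤ ENNReal.ofReal ε)
    {b c : ℝ} (hb : 0 < b) (hc : 0 ≤ c) (hlt : 0 < 1 - ε - Real.exp (-c)) :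
    WDD ν₀ ν₁ (cusumTime score b) ≤ ENNReal.ofReal ((b + c) / (1 - ε - Real.exp (-c))) := by
  refine iSup_le fun m => essSup_condLExp_le (history_le m) _ _ _ fun A hA => ?_
  have hBm : ∀ n, MeasurableSet (walkBelow score b c m n) := fun n =>
    history_le _ _ (measurableSet_walkBelow hs b c m n)
  calc ∫⁻ ω in A, (cusumTime score b ω : ℝ≥0∞) - (m : ℝ≥0∞) ∂(lawChange ν₀ ν₁ m)
      ≤ ∫⁻ ω in A, ∑' n, (walkBelow score b c m n).indicator 1 ω ∂(lawChange ν₀ ν₁ m) := by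
        refine lintegral_mono fun ω => ?_
        rw [toENNReal_tsub_eq_tsum]
        refine ENNReal.tsum_le_tsum fun n => ?_
        split_ifs with h
        · rw [Set.indicator_of_mem
            (noAlarm_subset_walkBelow score hb c m n (lt_cusumTime_iff.1 h)), Pi.one_apply]
        · exact zero_le
    _ = ∑' n, lawChange ν₀ ν₁ m (A ∩ walkBelow score b c m n) := by
        rw [lintegral_tsum fun n => (measurable_one.indicator (hBm n)).aemeasurable]
        refine tsum_congr fun n => ?_
        rw [lintegral_indicator_one (hBm n), Measure.restrict_apply (hBm n), Set.inter_comm]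
    _ ≤ _ := ENNReal.tsum_le_of_sum_range_le fun K =>
        sum_lawChange_inter_walkBelow_le ν₀ ν₁ hs hε hexp hb hc hlt m K hA

/-- First-order asymptotics of the worst-case detection delay. -/
theorem exists_WDD_cusumTime_le (ν₀ ν₁ : ProbabilityMeasure X) {score : X → ℝ}
    (hs : Measurable score) {ε : ℝ} (hε : 0 ≤ ε)
    (hexp : ∫⁻ x, ENNReal.ofReal (Real.exp (-score x)) ∂(ν₁ : Measure X) ≤ ENNReal.ofReal ε) :
    ∃ η : ℝ → ℝ, Tendsto η atTop (𝓝 0) ∧ ∀ᶠ b : ℝ in atTop,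
      WDD ν₀ ν₁ (cusumTime score b) ≤
        ENNReal.ofReal b / ENNReal.ofReal (1 - ε) * ENNReal.ofReal (1 + η b) := by
  rcases le_or_gt 1 ε with h1 | h1
  -- For `ε ≥ 1` the right side is a positive number divided by `0`, which is `∞` in `[0, ∞]`.
  · refine ⟨fun _ => 0, tendsto_const_nhds, ?_⟩
    filter_upwards [eventually_gt_atTop 0] with b hb
    have : ENNReal.ofReal (1 - ε) = 0 := ENNReal.ofReal_of_nonpos (by linarith)
    simp [this, ENNReal.div_zero, hb]
  · have hexp0 : Tendsto (fun b : ℝ => Real.exp (-√b)) atTop (𝓝 0) :=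
      Real.tendsto_exp_neg_atTop_nhds_zero.comp Real.tendsto_sqrt_atTop
    have hden : Tendsto (fun b : ℝ => 1 - ε - Real.exp (-√b)) atTop (𝓝 (1 - ε)) := by
      simpa using hexp0.const_sub (1 - ε)
    have hinv : Tendsto (fun b : ℝ => (√b)⁻¹) atTop (𝓝 0) :=
      tendsto_inv_atTop_zero.comp Real.tendsto_sqrt_atTop
    -- The truncation level is `c = √b`: it tends to infinity but is `o(b)`. The witness is the
    -- relative error of `(b + √b) / (1 - ε - exp(-√b))` against `b / (1 - ε)`.
    refine ⟨fun b => (1 + (√b)⁻¹) * (1 - ε) / (1 - ε - Real.exp (-√b)) - 1, ?_, ?_⟩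
    · have h2 : Tendsto (fun b : ℝ => (1 + (√b)⁻¹) * (1 - ε) / (1 - ε - Real.exp (-√b)) - 1) atTop
          (𝓝 ((1 + 0) * (1 - ε) / (1 - ε) - 1)) :=
        ((((hinv.const_add 1).mul_const (1 - ε)).div hden (by linarith)).sub_const 1)
      have h3 : (1 + 0) * (1 - ε) / (1 - ε) - 1 = 0 := by
        rw [add_zero, one_mul, div_self (by linarith), sub_self]
      rwa [h3] at h2
    · filter_upwards [eventually_gt_atTop 0, hden.eventually_const_lt (u := 0) (by linarith)]
        with b hb hlt
      refine (WDD_cusumTime_le ν₀ ν₁ hs hε hexp hb (Real.sqrt_nonneg b) hlt).trans_eq ?_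
      rw [← ENNReal.ofReal_div_of_pos (by linarith), ← ENNReal.ofReal_mul (by
        exact div_nonneg hb.le (by linarith))]
      congr 1
      have hsq : √b ≠ 0 := (Real.sqrt_pos.2 hb).ne'
      have : b * (√b)⁻¹ = √b := by
        field_simp
        rw [Real.sq_sqrt hb.le]
      have h1ε : 1 - ε ≠ 0 := by linarith
      rw [add_sub_cancel, div_mul_div_comm, mul_comm (1 - ε), ← mul_assoc, mul_div_mul_right _ _ h1ε,
        mul_add, mul_one, this]

end Detection

/-! ### Spectral and Frobenius norms -/

section Norms

variable {d : ℕ}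

theorem norm_toLp_sq (v : Fin d → ℝ) : ‖WithLp.toLp 2 v‖ ^ 2 = v ⬝ᵥ v := by
  rw [EuclideanSpace.real_norm_sq_eq]
  simp [dotProduct, sq]

theorem dotProduct_self_nonneg' (v : Fin d → ℝ) : 0 ≤ v ⬝ᵥ v := by
  rw [← norm_toLp_sq]; positivity

theorem dotProduct_mulVec_eq_transpose (A : Matrix (Fin d) (Fin d) ℝ) (v w : Fin d → ℝ) :
    v ⬝ᵥ A *ᵥ w = (Aᵀ *ᵥ v) ⬝ᵥ w := by
  rw [dotProduct_mulVec, mulVec_transpose]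

theorem specNorm_nonneg (A : Matrix (Fin d) (Fin d) ℝ) : 0 ≤ specNorm A := norm_nonneg _

theorem dotProduct_mulVec_self_le (A : Matrix (Fin d) (Fin d) ℝ) (v : Fin d → ℝ) :
    (A *ᵥ v) ⬝ᵥ (A *ᵥ v) ≤ specNorm A ^ 2 * (v ⬝ᵥ v) := by
  have h := (toEuclideanCLM (n := Fin d) (𝕜 := ℝ) A).le_opNorm (WithLp.toLp 2 v)
  rw [toEuclideanCLM_toLp] at h
  rw [← norm_toLp_sq, ← norm_toLp_sq, ← mul_pow]
  exact pow_le_pow_left₀ (norm_nonneg _) h 2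

theorem specNorm_le {A : Matrix (Fin d) (Fin d) ℝ} {C : ℝ} (hC : 0 ≤ C)
    (h : ∀ v, (A *ᵥ v) ⬝ᵥ (A *ᵥ v) ≤ C ^ 2 * (v ⬝ᵥ v)) : specNorm A ≤ C := by
  refine ContinuousLinearMap.opNorm_le_bound _ hC fun x => ?_
  have h' := h x.ofLp
  rw [← norm_toLp_sq, ← norm_toLp_sq, ← mul_pow, ← toEuclideanCLM_toLp] at h'
  exact (sq_le_sq₀ (norm_nonneg _) (by positivity)).1 h'

theorem specNorm_mul_le (A B : Matrix (Fin d) (Fin d) ℝ) :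
    specNorm (A * B) ≤ specNorm A * specNorm B := by
  rw [specNorm, map_mul]
  exact norm_mul_le _ _

theorem specNorm_add_le (A B : Matrix (Fin d) (Fin d) ℝ) :
    specNorm (A + B) ≤ specNorm A + specNorm B := by
  rw [specNorm, map_add]
  exact norm_add_le _ _

theorem specNorm_one_le : specNorm (1 : Matrix (Fin d) (Fin d) ℝ) ≤ 1 :=
  specNorm_le zero_le_one fun v => by simp

theorem specNorm_transpose (A : Matrix (Fin d) (Fin d) ℝ) : specNorm Aᵀ = specNorm A := by
  have h := l2_opNorm_conjTranspose A
  rw [conjTranspose_eq_transpose_of_trivial] at h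
  exact h

theorem abs_dotProduct_mulVec_le (A : Matrix (Fin d) (Fin d) ℝ) (v : Fin d → ℝ) :
    |v ⬝ᵥ A *ᵥ v| ≤ specNorm A * (v ⬝ᵥ v) := by
  refine abs_le_of_sq_le_sq ?_ (mul_nonneg (specNorm_nonneg A) (dotProduct_self_nonneg' v))
  have hcs : (v ⬝ᵥ A *ᵥ v) ^ 2 ≤ (v ⬝ᵥ v) * ((A *ᵥ v) ⬝ᵥ (A *ᵥ v)) := by
    simpa only [dotProduct, ← sq] using
      Finset.sum_mul_sq_le_sq_mul_sq Finset.univ v (A *ᵥ v)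
  calc (v ⬝ᵥ A *ᵥ v) ^ 2 ≤ (v ⬝ᵥ v) * ((A *ᵥ v) ⬝ᵥ (A *ᵥ v)) := hcs
    _ ≤ (v ⬝ᵥ v) * (specNorm A ^ 2 * (v ⬝ᵥ v)) :=
      mul_le_mul_of_nonneg_left (dotProduct_mulVec_self_le A v) (dotProduct_self_nonneg' v)
    _ = _ := by ring

/-- The spectral norm of a symmetric matrix is bounded by its numerical radius. -/
theorem specNorm_le_of_isSymm {A : Matrix (Fin d) (Fin d) ℝ} (hA : A.IsSymm) {C : ℝ} (hC : 0 ≤ C)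
    (h : ∀ v, |v ⬝ᵥ A *ᵥ v| ≤ C * (v ⬝ᵥ v)) : specNorm A ≤ C := by
  refine specNorm_le hC fun v => ?_
  set w := A *ᵥ v with hw
  -- Polarisation: subtract the quadratic form at `v - s w` from that at `v + s w` and use the
  -- parallelogram law. The choice `s = C⁻¹` then gives the claim; for `C = 0`, any positive `s`
  -- does.
  have key : ∀ s : ℝ, 2 * s * (w ⬝ᵥ w) ≤ C * (v ⬝ᵥ v + s ^ 2 * (w ⬝ᵥ w)) := by
    intro s
    have h1 := (abs_le.1 (h (v + s • w))).2
    have h2 := (abs_le.1 (h (v - s • w))).1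
    have hvw : v ⬝ᵥ A *ᵥ w = w ⬝ᵥ w := by
      rw [dotProduct_mulVec_eq_transpose, hA.eq]
    simp only [mulVec_add, mulVec_sub, mulVec_smul, add_dotProduct, sub_dotProduct, dotProduct_add,
      dotProduct_sub, smul_dotProduct, dotProduct_smul, smul_eq_mul, ← hw, hvw,
      dotProduct_comm w v] at h1 h2
    nlinarith
  rcases hC.eq_or_lt with rfl | hpos
  · have := key 1
    have := dotProduct_self_nonneg' w
    nlinarith
  · have := key C⁻¹
    have hne := hpos.ne'
    have h3 : C * (C * (v ⬝ᵥ v + C⁻¹ ^ 2 * (w ⬝ᵥ w))) = C ^ 2 * (v ⬝ᵥ v) + w ⬝ᵥ w := by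
      field_simp
    have h4 : C * (2 * C⁻¹ * (w ⬝ᵥ w)) = 2 * (w ⬝ᵥ w) := by field_simp
    have := mul_le_mul_of_nonneg_left this hpos.le
    linarith

theorem posDef_one_sub {A : Matrix (Fin d) (Fin d) ℝ} (hA : A.IsSymm) (h : specNorm A < 1) :
    (1 - A).PosDef := by
  refine PosDef.of_dotProduct_mulVec_pos ?_ fun v hv => ?_
  · rw [IsHermitian, conjTranspose_eq_transpose_of_trivial, transpose_sub, transpose_one, hA.eq]
  · have h1 := (abs_le.1 (abs_dotProduct_mulVec_le A v)).2
    have h2 : 0 < v ⬝ᵥ v := (dotProduct_self_nonneg' v).lt_of_ne'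
      (mt (dotProduct_self_eq_zero (v := v)).1 hv)
    rw [star_trivial, sub_mulVec, one_mulVec, dotProduct_sub]
    nlinarith

/-- The resolvent identity gives an inequality for the norm of the inverse, which is solved for that
norm. -/
theorem specNorm_inv_one_sub_le {A : Matrix (Fin d) (Fin d) ℝ} (h : specNorm A < 1)
    (hu : IsUnit (1 - A).det) : specNorm (1 - A)⁻¹ ≤ 1 / (1 - specNorm A) := by
  have heq : (1 - A)⁻¹ = 1 + (1 - A)⁻¹ * A := by
    have := nonsing_inv_mul (1 - A) hu
    rw [mul_sub, mul_one, sub_eq_iff_eq_add] at this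
    exact this
  have h1 : specNorm (1 - A)⁻¹ ≤ 1 + specNorm (1 - A)⁻¹ * specNorm A := by
    conv_lhs => rw [heq]
    exact (specNorm_add_le _ _).trans (add_le_add specNorm_one_le (specNorm_mul_le _ _))
  rw [le_div_iff₀ (by linarith)]
  linarith

theorem frobSq_nonneg (M : Matrix (Fin d) (Fin d) ℝ) : 0 ≤ frobSq M :=
  Finset.sum_nonneg fun _ _ => Finset.sum_nonneg fun _ _ => sq_nonneg _

theorem frobSq_transpose (M : Matrix (Fin d) (Fin d) ℝ) : frobSq Mᵀ = frobSq M :=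
  Finset.sum_comm

theorem frobSq_mul_le (A B : Matrix (Fin d) (Fin d) ℝ) :
    frobSq (A * B) ≤ specNorm A ^ 2 * frobSq B := by
  have hcol : ∀ M : Matrix (Fin d) (Fin d) ℝ, frobSq M = ∑ j, M.col j ⬝ᵥ M.col j := fun M => by
    rw [← frobSq_transpose]
    simp [frobSq, dotProduct, sq]
  rw [hcol, hcol, Finset.mul_sum]
  refine Finset.sum_le_sum fun j _ => ?_
  have : (A * B).col j = A *ᵥ B.col j := by
    ext i; simp [Matrix.mul_apply, mulVec, dotProduct]
  rw [this]
  exact dotProduct_mulVec_self_le A _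

theorem frobSq_mul_le' (A B : Matrix (Fin d) (Fin d) ℝ) :
    frobSq (A * B) ≤ specNorm B ^ 2 * frobSq A := by
  rw [← frobSq_transpose, transpose_mul, ← specNorm_transpose, ← frobSq_transpose A]
  exact frobSq_mul_le _ _

theorem trace_mul_le_sqrt_frobSq (M N : Matrix (Fin d) (Fin d) ℝ) :
    (M * N).trace ≤ √(frobSq M) * √(frobSq N) := by
  rw [← frobSq_transpose N]
  have h := Real.sum_mul_le_sqrt_mul_sqrt (Finset.univ : Finset (Fin d × Fin d))
    (fun p => M p.1 p.2) (fun p => Nᵀ p.1 p.2)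
  rw [Fintype.sum_prod_type, Fintype.sum_prod_type, Fintype.sum_prod_type] at h
  simpa [trace, Matrix.mul_apply, frobSq] using h

end Norms

/-! ### Determinants of positive definite matrices -/

section Determinants

variable {d : ℕ}

theorem isSymm_of_isHermitian {A : Matrix (Fin d) (Fin d) ℝ} (hA : A.IsHermitian) : A.IsSymm := by
  rwa [IsHermitian, conjTranspose_eq_transpose_of_trivial] at hA

theorem isSymm_sqrt (A : Matrix (Fin d) (Fin d) ℝ) : (CFC.sqrt A).IsSymm :=
  isSymm_of_isHermitian (CFC.sqrt_nonneg A).posSemidef.isHermitian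

theorem sqrt_mul_sqrt {A : Matrix (Fin d) (Fin d) ℝ} (hA : A.PosDef) :
    CFC.sqrt A * CFC.sqrt A = A :=
  CFC.sqrt_mul_sqrt_self A hA.posSemidef.nonneg

theorem isUnit_det_sqrt {A : Matrix (Fin d) (Fin d) ℝ} (hA : A.PosDef) :
    IsUnit (CFC.sqrt A).det := by
  refine isUnit_of_mul_isUnit_left (y := (CFC.sqrt A).det) ?_
  rw [← det_mul, sqrt_mul_sqrt hA]
  exact isUnit_iff_ne_zero.2 hA.det_pos.ne'

theorem isSymm_inv {A : Matrix (Fin d) (Fin d) ℝ} (hA : A.IsSymm) : A⁻¹.IsSymm := by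
  rw [IsSymm, transpose_nonsing_inv, hA.eq]

/-- This is `log x ≤ x - 1` summed over the eigenvalues. -/
theorem log_det_le_trace_sub {A : Matrix (Fin d) (Fin d) ℝ} (hA : A.PosDef) :
    Real.log A.det ≤ A.trace - d := by
  have hd := hA.isHermitian.det_eq_prod_eigenvalues
  have ht := hA.isHermitian.trace_eq_sum_eigenvalues
  simp only [RCLike.ofReal_real_eq_id, id_eq] at hd ht
  rw [hd, ht, Real.log_prod fun i _ => (hA.eigenvalues_pos i).ne']
  calc ∑ i, Real.log (hA.isHermitian.eigenvalues i)
      ≤ ∑ i, (hA.isHermitian.eigenvalues i - 1) :=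
        Finset.sum_le_sum fun i _ => Real.log_le_sub_one_of_pos (hA.eigenvalues_pos i)
    _ = _ := by simp

/-- Concavity of `log det`, as a gradient inequality. -/
theorem log_det_sub_log_det_le {A B : Matrix (Fin d) (Fin d) ℝ} (hA : A.PosDef) (hB : B.PosDef) :
    Real.log A.det - Real.log B.det ≤ (B⁻¹ * (A - B)).trace := by
  -- Whitening by `B^{-1/2}` reduces the claim to the comparison with the identity matrix.
  set S := CFC.sqrt B with hS
  have hSu : IsUnit S.det := isUnit_det_sqrt hB
  have hSS : S * S = B := sqrt_mul_sqrt hB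
  have hinv : S⁻¹ * S⁻¹ = B⁻¹ := by rw [← hSS, Matrix.mul_inv_rev]
  have hC : (S⁻¹ * A * S⁻¹).PosDef := by
    have := hA.mul_mul_conjTranspose_same (B := S⁻¹) (by
      rw [vecMul_injective_iff_isUnit, isUnit_nonsing_inv_iff, isUnit_iff_isUnit_det]
      exact hSu)
    rwa [conjTranspose_eq_transpose_of_trivial, (isSymm_inv (isSymm_sqrt B)).eq] at this
  have h := log_det_le_trace_sub hC
  have hdet : (S⁻¹ * A * S⁻¹).det = A.det * B.det⁻¹ := by
    rw [det_mul, det_mul, mul_comm (S⁻¹).det, mul_assoc, ← det_mul, hinv, det_nonsing_inv,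
      Ring.inverse_eq_inv']
  have htr : (S⁻¹ * A * S⁻¹).trace = (B⁻¹ * A).trace := by
    rw [mul_assoc, trace_mul_comm, mul_assoc, hinv, trace_mul_comm]
  rw [hdet, Real.log_mul hA.det_pos.ne' (inv_ne_zero hB.det_pos.ne'), Real.log_inv, htr] at h
  rw [mul_sub, nonsing_inv_mul _ (isUnit_iff_ne_zero.2 hB.det_pos.ne'), trace_sub, trace_one,
    Fintype.card_fin]
  linarith

theorem isSymm_conj {A : Matrix (Fin d) (Fin d) ℝ} (hA : A.IsSymm) (Q : Matrix (Fin d) (Fin d) ℝ) :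
    (Q * A * Qᵀ).IsSymm := by
  rw [IsSymm, transpose_mul, transpose_mul, transpose_transpose, hA.eq, mul_assoc]

theorem specNorm_conj_le (A : Matrix (Fin d) (Fin d) ℝ) {Q : Matrix (Fin d) (Fin d) ℝ}
    (hQ : specNorm Q ≤ 1) : specNorm (Q * A * Qᵀ) ≤ specNorm A := by
  have h1 := specNorm_mul_le (Q * A) Qᵀ
  have h2 := specNorm_mul_le Q A
  rw [specNorm_transpose] at h1
  have := specNorm_nonneg A
  have := specNorm_nonneg Q
  have := specNorm_nonneg (Q * A)
  nlinarith

/-- The cost in `log det` of replacing a symmetric matrix `A` by `Q A Qᵀ`, where `Q` is a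
contraction close to the identity. -/
theorem neg_log_det_one_sub_conj_le {A Q : Matrix (Fin d) (Fin d) ℝ} (hA : A.IsSymm)
    (hA1 : specNorm A < 1) (hQ : specNorm Q ≤ 1) {δ : ℝ} (hδ : specNorm (Q - 1) ≤ δ) :
    -Real.log (1 - Q * A * Qᵀ).det ≤ -Real.log (1 - A).det + (Q * A * Qᵀ - A).trace +
      2 * δ / (1 - specNorm A) * frobSq A := by
  set Y := Q * A * Qᵀ with hY
  have hYs : Y.IsSymm := isSymm_conj hA Q
  have hYA : specNorm Y ≤ specNorm A := specNorm_conj_le A hQ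
  have hY1 : specNorm Y < 1 := hYA.trans_lt hA1
  have hδ0 : 0 ≤ δ := (specNorm_nonneg _).trans hδ
  have hpY := posDef_one_sub hYs hY1
  have hu : IsUnit (1 - Y).det := isUnit_iff_ne_zero.2 hpY.det_pos.ne'
  have hgrad := log_det_sub_log_det_le (posDef_one_sub hA hA1) hpY
  set M := (1 - Y)⁻¹ * Y with hM
  have hinv : (1 - Y)⁻¹ = 1 + M := by
    have := nonsing_inv_mul (1 - Y) hu
    rw [mul_sub, mul_one, sub_eq_iff_eq_add] at this
    exact this
  -- The identity part of `(1 - Y)⁻¹ = 1 + M` produces the trace of `Y - A`. In the part paired with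
  -- `M`, `Y - A` is split into `(Q - 1) A Qᵀ` and `A (Q - 1)ᵀ`, each of Frobenius norm at most `δ`
  -- times that of `A`; the two pieces explain the factor `2 δ`.
  have hdec : (1 - Y)⁻¹ * (1 - A - (1 - Y)) =
      (Y - A) + M * ((Q - 1) * A * Qᵀ) + M * (A * (Q - 1)ᵀ) := by
    rw [hinv, hY, transpose_sub, transpose_one]
    noncomm_ring
  have hfY : frobSq Y ≤ frobSq A := by
    refine (frobSq_mul_le' _ _).trans ?_
    rw [specNorm_transpose]
    have h1 := frobSq_mul_le Q A
    have h2 : specNorm Q ^ 2 ≤ 1 := pow_le_one₀ (specNorm_nonneg _) hQ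
    have := frobSq_nonneg A
    have := frobSq_nonneg (Q * A)
    nlinarith
  have hfM : √(frobSq M) ≤ 1 / (1 - specNorm A) * √(frobSq A) := by
    refine Real.sqrt_le_iff.2 ⟨mul_nonneg (one_div_nonneg.2 (by linarith)) (Real.sqrt_nonneg _), ?_⟩
    rw [mul_pow, Real.sq_sqrt (frobSq_nonneg A)]
    refine (frobSq_mul_le _ _).trans (mul_le_mul ?_ hfY (frobSq_nonneg _) (sq_nonneg _))
    refine pow_le_pow_left₀ (specNorm_nonneg _) ((specNorm_inv_one_sub_le hY1 hu).trans ?_) 2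
    exact one_div_le_one_div_of_le (by linarith) (by linarith)
  have hN1 : √(frobSq ((Q - 1) * A * Qᵀ)) ≤ δ * √(frobSq A) := by
    refine Real.sqrt_le_iff.2 ⟨by positivity, ?_⟩
    rw [mul_pow, Real.sq_sqrt (frobSq_nonneg A)]
    refine (frobSq_mul_le' _ _).trans ?_
    rw [specNorm_transpose]
    have h1 := frobSq_mul_le (Q - 1) A
    have h2 : specNorm Q ^ 2 ≤ 1 := pow_le_one₀ (specNorm_nonneg _) hQ
    have h3 : specNorm (Q - 1) ^ 2 ≤ δ ^ 2 := pow_le_pow_left₀ (specNorm_nonneg _) hδ 2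
    have := mul_le_mul_of_nonneg_right h3 (frobSq_nonneg A)
    have := mul_le_mul_of_nonneg_right h2 (frobSq_nonneg ((Q - 1) * A))
    linarith
  have hN2 : √(frobSq (A * (Q - 1)ᵀ)) ≤ δ * √(frobSq A) := by
    refine Real.sqrt_le_iff.2 ⟨by positivity, ?_⟩
    rw [mul_pow, Real.sq_sqrt (frobSq_nonneg A)]
    refine (frobSq_mul_le' _ _).trans ?_
    rw [specNorm_transpose]
    exact mul_le_mul_of_nonneg_right (pow_le_pow_left₀ (specNorm_nonneg _) hδ 2) (frobSq_nonneg A)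
  have hpair : ∀ N : Matrix (Fin d) (Fin d) ℝ, √(frobSq N) ≤ δ * √(frobSq A) →
      (M * N).trace ≤ δ / (1 - specNorm A) * frobSq A := by
    intro N hN
    refine (trace_mul_le_sqrt_frobSq M N).trans ((mul_le_mul hfM hN (Real.sqrt_nonneg _)
      (mul_nonneg (one_div_nonneg.2 (by linarith)) (Real.sqrt_nonneg _))).trans_eq ?_)
    have := Real.mul_self_sqrt (frobSq_nonneg A)
    calc 1 / (1 - specNorm A) * √(frobSq A) * (δ * √(frobSq A))
        = δ / (1 - specNorm A) * (√(frobSq A) * √(frobSq A)) := by ring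
      _ = _ := by rw [this]
  rw [hdec, trace_add, trace_add] at hgrad
  have h1 := hpair _ hN1
  have h2 := hpair _ hN2
  have h3 : 2 * δ / (1 - specNorm A) * frobSq A =
      δ / (1 - specNorm A) * frobSq A + δ / (1 - specNorm A) * frobSq A := by ring
  linarith

end Determinants

/-! ### Exponential moments of quadratic functions of Gaussian vectors -/

/-- Completing the square: the integrand times the standard density is a constant times the density
of the normal law with mean `c / (1 - l)` and variance `1 / (1 - l)`. -/
theorem lintegral_exp_quadratic_gaussianReal {l : ℝ} (hl : l < 1) (c : ℝ) :
    ∫⁻ x, ENNReal.ofReal (Real.exp (1 / 2 * l * x ^ 2 + c * x)) ∂(gaussianReal 0 1) =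
      ENNReal.ofReal (Real.exp (-(1 / 2) * Real.log (1 - l) + 1 / 2 * (c ^ 2 / (1 - l)))) := by
  have hpos : 0 < 1 - l := by linarith
  set v : NNReal := ⟨(1 - l)⁻¹, (inv_pos.2 hpos).le⟩ with hv
  have hvc : (v : ℝ) = (1 - l)⁻¹ := rfl
  have hv0 : v ≠ 0 := by
    rw [← NNReal.coe_ne_zero, hvc]; exact inv_ne_zero hpos.ne'
  have hroot : Real.exp (-(1 / 2) * Real.log (1 - l)) = √v := by
    rw [hvc, Real.sqrt_eq_rpow, Real.rpow_def_of_pos (inv_pos.2 hpos), Real.log_inv]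
    congr 1; ring
  rw [gaussianReal_of_var_ne_zero 0 one_ne_zero,
    lintegral_withDensity_eq_lintegral_mul _ (measurable_gaussianPDF 0 1) (by fun_prop)]
  have hpt : ∀ x, (gaussianPDF 0 1 * fun x => ENNReal.ofReal
      (Real.exp (1 / 2 * l * x ^ 2 + c * x))) x =
      ENNReal.ofReal (Real.exp (-(1 / 2) * Real.log (1 - l) + 1 / 2 * (c ^ 2 / (1 - l)))) *
        gaussianPDF (c / (1 - l)) v x := by
    intro x
    rw [Pi.mul_apply, gaussianPDF, gaussianPDF, ← ENNReal.ofReal_mul (gaussianPDFReal_nonneg _ _ _),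
      ← ENNReal.ofReal_mul (Real.exp_pos _).le, gaussianPDFReal, gaussianPDFReal, Real.exp_add _
        (1 / 2 * (c ^ 2 / (1 - l))), hroot, Real.sqrt_mul (by positivity) (v : ℝ)]
    congr 1
    have hsv : √(v : ℝ) ≠ 0 := by
      rw [Real.sqrt_ne_zero']
      exact NNReal.coe_pos.2 (pos_iff_ne_zero.2 hv0)
    rw [mul_inv]
    have he : Real.exp (-(x - 0) ^ 2 / (2 * ((1 : NNReal) : ℝ))) *
        Real.exp (1 / 2 * l * x ^ 2 + c * x) =
        Real.exp (1 / 2 * (c ^ 2 / (1 - l))) *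
          Real.exp (-(x - c / (1 - l)) ^ 2 / (2 * (v : ℝ))) := by
      rw [← Real.exp_add, ← Real.exp_add, hvc]
      congr 1
      rw [NNReal.coe_one]
      field_simp
      ring
    calc (√(2 * Real.pi * ((1 : NNReal) : ℝ)))⁻¹ *
          Real.exp (-(x - 0) ^ 2 / (2 * ((1 : NNReal) : ℝ))) *
          Real.exp (1 / 2 * l * x ^ 2 + c * x)
        = (√(2 * Real.pi))⁻¹ * (Real.exp (-(x - 0) ^ 2 / (2 * ((1 : NNReal) : ℝ))) *
          Real.exp (1 / 2 * l * x ^ 2 + c * x)) := by rw [NNReal.coe_one, mul_one, mul_assoc]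
      _ = (√v * (√v)⁻¹) * (√(2 * Real.pi))⁻¹ * (Real.exp (1 / 2 * (c ^ 2 / (1 - l))) *
          Real.exp (-(x - c / (1 - l)) ^ 2 / (2 * (v : ℝ)))) := by
          rw [he, mul_inv_cancel₀ hsv, one_mul]
      _ = _ := by ring
  simp_rw [hpt]
  rw [lintegral_const_mul _ (measurable_gaussianPDF _ _), lintegral_gaussianPDF_eq_one _ hv0,
    mul_one]

section

variable {d : ℕ}

theorem det_one_sub_eq_prod {A : Matrix (Fin d) (Fin d) ℝ} (hA : A.IsHermitian) :
    (1 - A).det = ∏ i, (1 - hA.eigenvalues i) := by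
  have h := eval_charpoly A 1
  rw [map_one, hA.charpoly_eq, Polynomial.eval_prod] at h
  rw [← h]
  simp

/-- A bilinear form in the coordinates of an eigenbasis. -/
theorem dotProduct_mulVec_eq_sum_eigenvalues {A : Matrix (Fin d) (Fin d) ℝ} (hA : A.IsHermitian)
    (x z : Fin d → ℝ) :
    x ⬝ᵥ A *ᵥ z = ∑ i, hA.eigenvalues i *
      (((hA.eigenvectorBasis i).ofLp ⬝ᵥ x) * ((hA.eigenvectorBasis i).ofLp ⬝ᵥ z)) := by
  have h := hA.eigenvectorBasis.sum_inner_mul_inner (WithLp.toLp 2 x) (WithLp.toLp 2 (A *ᵥ z))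
  simp only [EuclideanSpace.inner_eq_star_dotProduct, star_trivial] at h
  rw [dotProduct_comm, ← h]
  refine Finset.sum_congr rfl fun i _ => ?_
  have h1 : (A *ᵥ z) ⬝ᵥ (hA.eigenvectorBasis i).ofLp =
      hA.eigenvalues i * ((hA.eigenvectorBasis i).ofLp ⬝ᵥ z) := by
    rw [dotProduct_comm, dotProduct_mulVec_eq_transpose, (isSymm_of_isHermitian hA).eq,
      hA.mulVec_eigenvectorBasis i, smul_dotProduct, smul_eq_mul]
  rw [h1]
  ring

theorem dotProduct_eq_sum_eigenvectorBasis {A : Matrix (Fin d) (Fin d) ℝ} (hA : A.IsHermitian)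
    (x z : Fin d → ℝ) :
    x ⬝ᵥ z = ∑ i,
      (((hA.eigenvectorBasis i).ofLp ⬝ᵥ x) * ((hA.eigenvectorBasis i).ofLp ⬝ᵥ z)) := by
  have h := hA.eigenvectorBasis.sum_inner_mul_inner (WithLp.toLp 2 x) (WithLp.toLp 2 z)
  simp only [EuclideanSpace.inner_eq_star_dotProduct, star_trivial] at h
  rw [dotProduct_comm, ← h]
  refine Finset.sum_congr rfl fun i _ => ?_
  rw [dotProduct_comm z]

/-- In an eigenbasis of `A` the coordinates are independent standard normal variables, so the
integral is a product of one-dimensional ones. Writing the linear term as `(1 - A) v` avoids the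
inverse matrix. -/
theorem lintegral_exp_quadratic_stdGaussian {A : Matrix (Fin d) (Fin d) ℝ} (hA : A.IsHermitian)
    (hpos : (1 - A).PosDef) (v : Fin d → ℝ) :
    ∫⁻ x, ENNReal.ofReal (Real.exp (1 / 2 * (x.ofLp ⬝ᵥ A *ᵥ x.ofLp) + ((1 - A) *ᵥ v) ⬝ᵥ x.ofLp))
        ∂(stdGaussian (EuclideanSpace ℝ (Fin d))) =
      ENNReal.ofReal (Real.exp (-(1 / 2) * Real.log (1 - A).det +
        1 / 2 * (v ⬝ᵥ (1 - A) *ᵥ v))) := by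
  set e := hA.eigenvectorBasis with he
  set l := hA.eigenvalues with hl
  have hsymm : (1 - A)ᵀ = 1 - A := (isSymm_of_isHermitian hpos.isHermitian).eq
  have hform : ∀ x z : Fin d → ℝ, x ⬝ᵥ (1 - A) *ᵥ z =
      ∑ i, (1 - l i) * (((e i).ofLp ⬝ᵥ x) * ((e i).ofLp ⬝ᵥ z)) := by
    intro x z
    rw [sub_mulVec, one_mulVec, dotProduct_sub, dotProduct_eq_sum_eigenvectorBasis hA x z,
      dotProduct_mulVec_eq_sum_eigenvalues hA x z, ← Finset.sum_sub_distrib]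
    refine Finset.sum_congr rfl fun i _ => ?_
    ring
  have hee : ∀ i j, (e i).ofLp ⬝ᵥ (e j).ofLp = if i = j then 1 else 0 := by
    intro i j
    have := orthonormal_iff_ite.1 e.orthonormal i j
    rw [EuclideanSpace.inner_eq_star_dotProduct, star_trivial, dotProduct_comm] at this
    exact this
  have hl1 : ∀ i, l i < 1 := by
    intro i
    have hne : (e i).ofLp ≠ 0 := by
      intro h0
      have := hee i i
      rw [h0] at this
      simp at this
    have := hpos.dotProduct_mulVec_pos hne
    rw [star_trivial, hform] at this
    simp only [hee, mul_ite, mul_one, mul_zero, Finset.sum_ite_eq',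
      Finset.mem_univ, if_true] at this
    linarith
  rw [stdGaussian_eq_map_pi_orthonormalBasis e, lintegral_map]
  rotate_left
  · simp only [dotProduct, mulVec]
    fun_prop
  · fun_prop
  have hcoord : ∀ (y : Fin d → ℝ) i, (e i).ofLp ⬝ᵥ (∑ j, y j • e j).ofLp = y i := by
    intro y i
    rw [WithLp.ofLp_sum, dotProduct_sum]
    simp only [WithLp.ofLp_smul, dotProduct_smul, hee, smul_eq_mul, mul_ite, mul_one, mul_zero,
      Finset.sum_ite_eq, Finset.mem_univ, if_true]
  have hpt : ∀ y : Fin d → ℝ, ENNReal.ofReal (Real.exp (1 / 2 * ((∑ j, y j • e j).ofLp ⬝ᵥ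
      A *ᵥ (∑ j, y j • e j).ofLp) + ((1 - A) *ᵥ v) ⬝ᵥ (∑ j, y j • e j).ofLp)) =
      ∏ i, ENNReal.ofReal (Real.exp (1 / 2 * l i * y i ^ 2 +
        ((1 - l i) * ((e i).ofLp ⬝ᵥ v)) * y i)) := by
    intro y
    rw [← ENNReal.ofReal_prod_of_nonneg fun i _ => (Real.exp_pos _).le, ← Real.exp_sum,
      dotProduct_mulVec_eq_sum_eigenvalues hA, ← hsymm, ← dotProduct_mulVec_eq_transpose, hform,
      Finset.mul_sum, ← Finset.sum_add_distrib]
    congr 2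
    refine Finset.sum_congr rfl fun i _ => ?_
    rw [← he, hcoord]
    ring
  simp_rw [hpt]
  have hind := iIndepFun_pi (μ := fun _ : Fin d => gaussianReal 0 1)
    (X := fun i (t : ℝ) => ENNReal.ofReal (Real.exp (1 / 2 * l i * t ^ 2 +
        ((1 - l i) * ((e i).ofLp ⬝ᵥ v)) * t))) (fun i => by fun_prop)
  rw [lintegral_prod_eq_prod_lintegral_of_indepFun Finset.univ _ hind (fun i => by fun_prop)]
  have hone : ∀ i, ∫⁻ y : Fin d → ℝ, ENNReal.ofReal (Real.exp (1 / 2 * l i * y i ^ 2 +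
        ((1 - l i) * ((e i).ofLp ⬝ᵥ v)) * y i)) ∂(Measure.pi fun _ => gaussianReal 0 1) =
      ENNReal.ofReal (Real.exp (-(1 / 2) * Real.log (1 - l i) +
        1 / 2 * ((1 - l i) * (((e i).ofLp ⬝ᵥ v) * ((e i).ofLp ⬝ᵥ v))))) := by
    intro i
    rw [(measurePreserving_eval (fun _ : Fin d => gaussianReal 0 1) i).lintegral_comp
      (f := fun t => ENNReal.ofReal (Real.exp (1 / 2 * l i * t ^ 2 +
        ((1 - l i) * ((e i).ofLp ⬝ᵥ v)) * t))) (by fun_prop),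
      lintegral_exp_quadratic_gaussianReal (hl1 i)]
    congr 4
    have : 1 - l i ≠ 0 := by linarith [hl1 i]
    field_simp
  simp_rw [hone]
  rw [← ENNReal.ofReal_prod_of_nonneg fun i _ => (Real.exp_pos _).le, ← Real.exp_sum,
    det_one_sub_eq_prod hA, Real.log_prod fun i _ => by linarith [hl1 i], hform,
    Finset.sum_add_distrib, Finset.mul_sum, Finset.mul_sum]

/-- The exponential moment of a quadratic function of a Gaussian vector. -/
theorem lintegral_exp_quadratic_multivariateGaussian (u h : Fin d → ℝ)
    {H Θ : Matrix (Fin d) (Fin d) ℝ} (hH : H.IsSymm)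
    (hpos : (1 - CFC.sqrt Θ * H * CFC.sqrt Θ).PosDef) :
    ∫⁻ x, ENNReal.ofReal (Real.exp (1 / 2 * (x.ofLp ⬝ᵥ H *ᵥ x.ofLp) + h ⬝ᵥ x.ofLp))
        ∂(multivariateGaussian (WithLp.toLp 2 u) Θ) =
      ENNReal.ofReal (Real.exp (-(1 / 2) * Real.log (1 - CFC.sqrt Θ * H * CFC.sqrt Θ).det +
        (1 / 2 * (u ⬝ᵥ H *ᵥ u) + h ⬝ᵥ u) +
        1 / 2 * ((CFC.sqrt Θ *ᵥ (H *ᵥ u + h)) ⬝ᵥ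
          (1 - CFC.sqrt Θ * H * CFC.sqrt Θ)⁻¹ *ᵥ (CFC.sqrt Θ *ᵥ (H *ᵥ u + h))))) := by
  set R := CFC.sqrt Θ with hR
  have hRs : Rᵀ = R := (isSymm_sqrt Θ).eq
  set A := R * H * R with hA
  have hAh : A.IsHermitian := by
    rw [IsHermitian, conjTranspose_eq_transpose_of_trivial, hA, transpose_mul, transpose_mul, hRs,
      hH.eq, mul_assoc]
  set w := R *ᵥ (H *ᵥ u + h) with hw
  set v := (1 - A)⁻¹ *ᵥ w with hv
  have hwv : (1 - A) *ᵥ v = w := by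
    rw [hv, mulVec_mulVec, mul_nonsing_inv _ (isUnit_iff_ne_zero.2 hpos.det_pos.ne'), one_mulVec]
  rw [multivariateGaussian, lintegral_map]
  rotate_left
  · simp only [dotProduct, mulVec]
    fun_prop
  · fun_prop
  have hpt : ∀ x : EuclideanSpace ℝ (Fin d), ENNReal.ofReal (Real.exp (1 / 2 *
      ((WithLp.toLp 2 u + toEuclideanCLM (𝕜 := ℝ) R x).ofLp ⬝ᵥ
        H *ᵥ (WithLp.toLp 2 u + toEuclideanCLM (𝕜 := ℝ) R x).ofLp) +
      h ⬝ᵥ (WithLp.toLp 2 u + toEuclideanCLM (𝕜 := ℝ) R x).ofLp)) =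
      ENNReal.ofReal (Real.exp (1 / 2 * (u ⬝ᵥ H *ᵥ u) + h ⬝ᵥ u)) *
        ENNReal.ofReal (Real.exp (1 / 2 * (x.ofLp ⬝ᵥ A *ᵥ x.ofLp) +
          ((1 - A) *ᵥ v) ⬝ᵥ x.ofLp)) := by
    intro x
    rw [← ENNReal.ofReal_mul (Real.exp_pos _).le, ← Real.exp_add, hwv]
    congr 2
    have h1 : x.ofLp ⬝ᵥ A *ᵥ x.ofLp = (R *ᵥ x.ofLp) ⬝ᵥ H *ᵥ (R *ᵥ x.ofLp) := by
      rw [hA, mul_assoc, ← mulVec_mulVec, dotProduct_mulVec_eq_transpose, hRs, mulVec_mulVec]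
    have h2 : w ⬝ᵥ x.ofLp = (H *ᵥ u + h) ⬝ᵥ (R *ᵥ x.ofLp) := by
      rw [hw, dotProduct_mulVec_eq_transpose, hRs]
    have h3 : u ⬝ᵥ H *ᵥ (R *ᵥ x.ofLp) = (H *ᵥ u) ⬝ᵥ (R *ᵥ x.ofLp) := by
      rw [dotProduct_mulVec_eq_transpose, hH.eq]
    rw [h1, h2, WithLp.ofLp_add, ofLp_toEuclideanCLM, mulVec_add, dotProduct_add, add_dotProduct,
      add_dotProduct, dotProduct_add, add_dotProduct, h3,
      dotProduct_comm (R *ᵥ x.ofLp) (H *ᵥ u)]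
    ring
  rw [lintegral_congr hpt, lintegral_const_mul', lintegral_exp_quadratic_stdGaussian hAh hpos,
    ← ENNReal.ofReal_mul (Real.exp_pos _).le, ← Real.exp_add, hwv, dotProduct_comm v w]
  · congr 2
    ring
  · exact ENNReal.ofReal_ne_top

end

/-! ### The bound `Φ` for the logarithmic exponential moments -/

theorem trace_vecMulVec_mul_eq {n : Type*} [Fintype n] (l : n → ℝ) (Y : Matrix n n ℝ) :
    (vecMulVec l l * Y).trace = l ⬝ᵥ Y *ᵥ l := by
  rw [vecMulVec_mul, trace_vecMulVec, dotProduct_comm, dotProduct_mulVec, dotProduct_comm]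

/-- Variational lower bound for the inverse of a positive definite quadratic form. -/
theorem two_mul_dotProduct_sub_le {d : ℕ} {P : Matrix (Fin d) (Fin d) ℝ} (hP : P.PosDef)
    (g z : Fin d → ℝ) : 2 * (g ⬝ᵥ z) - z ⬝ᵥ P *ᵥ z ≤ g ⬝ᵥ P⁻¹ *ᵥ g := by
  have hu : IsUnit P.det := isUnit_iff_ne_zero.2 hP.det_pos.ne'
  have h := hP.posSemidef.dotProduct_mulVec_nonneg (P⁻¹ *ᵥ g - z)
  have hs : Pᵀ = P := (isSymm_of_isHermitian hP.isHermitian).eq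
  have h1 : P *ᵥ (P⁻¹ *ᵥ g) = g := by rw [mulVec_mulVec, mul_nonsing_inv _ hu, one_mulVec]
  have h2 : (P⁻¹ *ᵥ g) ⬝ᵥ P *ᵥ z = g ⬝ᵥ z := by
    rw [dotProduct_mulVec_eq_transpose, hs, h1]
  rw [star_trivial, mulVec_sub, h1, sub_dotProduct, dotProduct_sub, dotProduct_sub, h2,
    dotProduct_comm z g, dotProduct_comm (P⁻¹ *ᵥ g) g] at h
  linarith

namespace UncertaintyData

variable {d : ℕ} (D : UncertaintyData d)

theorem le_supportZ {M : Matrix (Fin d ⊕ Unit) (Fin d ⊕ Unit) ℝ} (hM : M ∈ D.Z)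
    (Y : Matrix (Fin d ⊕ Unit) (Fin d ⊕ Unit) ℝ) : (M * Y).trace ≤ D.supportZ Y := by
  refine le_csSup (D.isCompact_Z.image ?_).bddAbove (Set.mem_image_of_mem _ hM)
  exact (continuous_id.matrix_mul continuous_const).matrix_trace

/-- All terms depending on the mean `u` form one linear functional of `[u; 1][u; 1]ᵀ`, which the
support function of `𝒵` can bound. -/
theorem dotProduct_liftedForm (u h : Fin d → ℝ) (H : Matrix (Fin d) (Fin d) ℝ) :
    lift1 u ⬝ᵥ D.liftedForm h H *ᵥ lift1 u =
      u ⬝ᵥ H *ᵥ u + 2 * (h ⬝ᵥ u) + (H *ᵥ u + h) ⬝ᵥ (D.ΘStar⁻¹ - H)⁻¹ *ᵥ (H *ᵥ u + h) := by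
  have hcol : replicateCol Unit h *ᵥ (fun _ : Unit => (1 : ℝ)) = h := by
    ext i; simp [mulVec, dotProduct]
  have hrow : replicateRow Unit h *ᵥ u = fun _ : Unit => h ⬝ᵥ u := by
    ext i; simp [mulVec, dotProduct]
  have hg : fromCols H (replicateCol Unit h) *ᵥ lift1 u = H *ᵥ u + h := by
    rw [lift1, fromCols_mulVec_sumElim, hcol]
  have h1 : lift1 u ⬝ᵥ fromBlocks H (replicateCol Unit h) (replicateRow Unit h) 0 *ᵥ lift1 u =
      u ⬝ᵥ H *ᵥ u + 2 * (h ⬝ᵥ u) := by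
    rw [lift1, fromBlocks_mulVec, Sum.elim_comp_inl, Sum.elim_comp_inr, hcol, hrow, zero_mulVec,
      add_zero, sumElim_dotProduct_sumElim, dotProduct_add, dotProduct_comm u h]
    simp [dotProduct]
    ring
  rw [liftedForm, add_mulVec, dotProduct_add, h1, ← mulVec_mulVec, ← mulVec_mulVec, hg,
    dotProduct_mulVec (lift1 u), vecMul_transpose, hg]

variable {D}

/-- The bound `Θ_*` is only assumed semidefinite; a positive definite matrix below it forces it to
be positive definite. -/
theorem posDef_ΘStar {Θ : Matrix (Fin d) (Fin d) ℝ} (hΘ : Θ ∈ D.U) : D.ΘStar.PosDef := by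
  have := (D.posDef_of_mem_U Θ hΘ).add_posSemidef (D.le_ΘStar Θ hΘ)
  rwa [add_sub_cancel] at this

theorem isSymm_conj {H : Matrix (Fin d) (Fin d) ℝ} (hH : H.IsSymm) : (D.conj H).IsSymm := by
  have := RobustCusum.isSymm_conj hH (CFC.sqrt D.ΘStar)
  rwa [(isSymm_sqrt _).eq] at this

/-- Conjugation by `Θ_*^{1/2}` turns the defining bounds on `H` into `-β I ⪯ Ĥ ⪯ β I`. -/
theorem specNorm_conj_le (hpos : D.ΘStar.PosDef) {p : (Fin d → ℝ) × Matrix (Fin d) (Fin d) ℝ}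
    (hp : p ∈ D.detectors) : specNorm (D.conj p.2) ≤ D.β := by
  obtain ⟨hs, hlo, hup⟩ := hp
  refine specNorm_le_of_isSymm (isSymm_conj hs) D.β_nonneg fun v => ?_
  set S := CFC.sqrt D.ΘStar with hS
  have hSu : IsUnit S.det := isUnit_det_sqrt hpos
  have hSs : Sᵀ = S := (isSymm_sqrt D.ΘStar).eq
  have hinv : S * D.ΘStar⁻¹ * S = 1 := by
    rw [← sqrt_mul_sqrt hpos, ← hS, Matrix.mul_inv_rev, ← mul_assoc, mul_nonsing_inv _ hSu, one_mul,
      nonsing_inv_mul _ hSu]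
  have hform : ∀ M : Matrix (Fin d) (Fin d) ℝ, (S *ᵥ v) ⬝ᵥ M *ᵥ (S *ᵥ v) = v ⬝ᵥ (S * M * S) *ᵥ v := by
    intro M
    rw [mul_assoc, ← mulVec_mulVec v S, dotProduct_mulVec_eq_transpose S, hSs, mulVec_mulVec]
  have h1 := hlo.dotProduct_mulVec_nonneg (S *ᵥ v)
  have h2 := hup.dotProduct_mulVec_nonneg (S *ᵥ v)
  rw [star_trivial, hform] at h1 h2
  rw [sub_neg_eq_add, mul_add, add_mul, mul_smul_comm, smul_mul_assoc, hinv, add_mulVec,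
    smul_mulVec, one_mulVec, dotProduct_add, dotProduct_smul, smul_eq_mul] at h1
  rw [mul_sub, sub_mul, mul_smul_comm, smul_mul_assoc, hinv, sub_mulVec,
    smul_mulVec, one_mulVec, dotProduct_sub, dotProduct_smul, smul_eq_mul] at h2
  rw [abs_le, conj]
  constructor <;> linarith

/-- The squared norm of the image of `v` is the form of `Θ` at `Θ_*^{-1/2} v`, hence at most the
form of `Θ_*` there, which is the squared norm of `v`. -/
theorem specNorm_sqrt_mul_inv_sqrt_le_one {Θ : Matrix (Fin d) (Fin d) ℝ} (hΘ : Θ ∈ D.U) :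
    specNorm (CFC.sqrt Θ * (CFC.sqrt D.ΘStar)⁻¹) ≤ 1 := by
  have hpos := posDef_ΘStar hΘ
  set S := CFC.sqrt D.ΘStar with hS
  set R := CFC.sqrt Θ with hR
  have hSu : IsUnit S.det := isUnit_det_sqrt hpos
  have hSs : Sᵀ = S := (isSymm_sqrt D.ΘStar).eq
  have hRs : Rᵀ = R := (isSymm_sqrt Θ).eq
  refine specNorm_le zero_le_one fun v => ?_
  have hsq : ∀ (M : Matrix (Fin d) (Fin d) ℝ) (x : Fin d → ℝ), Mᵀ = M →
      (M *ᵥ x) ⬝ᵥ (M *ᵥ x) = x ⬝ᵥ (M * M) *ᵥ x := by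
    intro M x hM
    rw [← mulVec_mulVec, dotProduct_mulVec_eq_transpose M x, hM]
  have h := (D.le_ΘStar Θ hΘ).dotProduct_mulVec_nonneg (S⁻¹ *ᵥ v)
  rw [star_trivial, sub_mulVec, dotProduct_sub, ← sqrt_mul_sqrt hpos,
    ← sqrt_mul_sqrt (D.posDef_of_mem_U Θ hΘ), ← hsq _ _ hRs, ← hsq _ _ hSs,
    mulVec_mulVec v S, mul_nonsing_inv _ hSu, one_mulVec, mulVec_mulVec] at h
  linarith

/-- The function `Φ` bounds the logarithmic exponential moments of the quadratic functions given by
`detectors` under the laws in `gaussians`. -/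
theorem lintegral_exp_quadratic_le {p : (Fin d → ℝ) × Matrix (Fin d) (Fin d) ℝ}
    (hp : p ∈ D.detectors) {u : Fin d → ℝ} {Θ : Matrix (Fin d) (Fin d) ℝ} (hΘ : Θ ∈ D.U)
    (hu : vecMulVec (lift1 u) (lift1 u) ∈ D.Z) :
    ∫⁻ x, ENNReal.ofReal (Real.exp (1 / 2 * (x.ofLp ⬝ᵥ p.2 *ᵥ x.ofLp) + p.1 ⬝ᵥ x.ofLp))
        ∂(multivariateGaussian (WithLp.toLp 2 u) Θ) ≤
      ENNReal.ofReal (Real.exp (D.Phi p.1 p.2 Θ)) := by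
  obtain ⟨h, H⟩ := p
  have hH : H.IsSymm := hp.1
  have hpos := posDef_ΘStar hΘ
  have hΘpos := D.posDef_of_mem_U Θ hΘ
  have hconj1 : specNorm (D.conj H) < 1 := (specNorm_conj_le hpos hp).trans_lt D.β_lt_one
  have hQ1 := specNorm_sqrt_mul_inv_sqrt_le_one hΘ
  have hQδ := D.le_δ Θ hΘ
  set S := CFC.sqrt D.ΘStar with hS
  set R := CFC.sqrt Θ with hR
  have hSu : IsUnit S.det := isUnit_det_sqrt hpos
  have hSs : Sᵀ = S := (isSymm_sqrt D.ΘStar).eq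
  have hSi : S⁻¹ᵀ = S⁻¹ := (isSymm_inv (isSymm_sqrt D.ΘStar)).eq
  have hRs : Rᵀ = R := (isSymm_sqrt Θ).eq
  have hSS : S * S = D.ΘStar := sqrt_mul_sqrt hpos
  have hRR : R * R = Θ := sqrt_mul_sqrt hΘpos
  -- `Q` is a contraction within `δ` of the identity and carries `Ĥ` to `Θ^{1/2} H Θ^{1/2}`, the
  -- matrix in the exact Gaussian formula.
  set Q := R * S⁻¹ with hQ
  have hQt : Qᵀ = S⁻¹ * R := by rw [hQ, transpose_mul, hSi, hRs]
  have hY : Q * D.conj H * Qᵀ = R * H * R := by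
    rw [hQt, hQ, conj, ← hS]
    calc R * S⁻¹ * (S * H * S) * (S⁻¹ * R) = R * (S⁻¹ * S) * H * (S * S⁻¹) * R := by
          simp only [mul_assoc]
      _ = _ := by rw [nonsing_inv_mul _ hSu, mul_nonsing_inv _ hSu, mul_one, mul_one]
  have hdet := neg_log_det_one_sub_conj_le (isSymm_conj hH) hconj1 hQ1 hQδ
  have hYpos : (1 - R * H * R).PosDef := by
    rw [← hY]
    exact posDef_one_sub (RobustCusum.isSymm_conj (isSymm_conj hH) Q)
      ((RobustCusum.specNorm_conj_le _ hQ1).trans_lt hconj1)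
  have htr : (R * H * R - D.conj H).trace = ((Θ - D.ΘStar) * H).trace := by
    rw [conj, ← hS, trace_sub, sub_mul, trace_sub, trace_mul_comm, ← mul_assoc, hRR,
      trace_mul_comm (S * H), ← mul_assoc, hSS]
  rw [hY, htr] at hdet
  rw [lintegral_exp_quadratic_multivariateGaussian u h hH hYpos]
  refine ENNReal.ofReal_le_ofReal (Real.exp_le_exp.2 ?_)
  set g := H *ᵥ u + h with hg
  set A := R * H * R with hA
  set v := (1 - A)⁻¹ *ᵥ (R *ᵥ g) with hv
  have hAv : (1 - A) *ᵥ v = R *ᵥ g := by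
    rw [hv, mulVec_mulVec, mul_nonsing_inv _ (isUnit_iff_ne_zero.2 hYpos.det_pos.ne'), one_mulVec]
  have hPform : S⁻¹ * (1 - D.conj H) * S⁻¹ = D.ΘStar⁻¹ - H := by
    rw [conj, ← hS, mul_sub, sub_mul, mul_one, ← hSS, Matrix.mul_inv_rev]
    congr 1
    calc S⁻¹ * (S * H * S) * S⁻¹ = (S⁻¹ * S) * H * (S * S⁻¹) := by simp only [mul_assoc]
      _ = H := by rw [nonsing_inv_mul _ hSu, mul_nonsing_inv _ hSu, mul_one, one_mul]
  have hP : (D.ΘStar⁻¹ - H).PosDef := by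
    rw [← hPform]
    have := (posDef_one_sub (isSymm_conj hH) hconj1).mul_mul_conjTranspose_same (B := S⁻¹) (by
      rw [vecMul_injective_iff_isUnit, isUnit_nonsing_inv_iff, isUnit_iff_isUnit_det]
      exact hSu)
    rwa [conjTranspose_eq_transpose_of_trivial, hSi] at this
  -- The variational bound is taken at `z = Θ^{1/2} v`. As `Qᵀ` is a contraction, its left side is
  -- at least `2 (R g ⬝ᵥ v) - v ⬝ᵥ (1 - A) v`, which equals `R g ⬝ᵥ v` by the definition of `v`.
  have hmean : (R *ᵥ g) ⬝ᵥ v ≤ g ⬝ᵥ (D.ΘStar⁻¹ - H)⁻¹ *ᵥ g := by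
    refine le_trans ?_ (two_mul_dotProduct_sub_le hP g (R *ᵥ v))
    have h1 : g ⬝ᵥ R *ᵥ v = (R *ᵥ g) ⬝ᵥ v := by rw [dotProduct_mulVec_eq_transpose, hRs]
    have h2 : (R *ᵥ v) ⬝ᵥ (D.ΘStar⁻¹ - H) *ᵥ (R *ᵥ v) =
        (Qᵀ *ᵥ v) ⬝ᵥ (Qᵀ *ᵥ v) - v ⬝ᵥ A *ᵥ v := by
      have e1 : v ⬝ᵥ A *ᵥ v = (R *ᵥ v) ⬝ᵥ H *ᵥ (R *ᵥ v) := by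
        rw [hA, mul_assoc, ← mulVec_mulVec, dotProduct_mulVec_eq_transpose, hRs, mulVec_mulVec v H R]
      have e2 : (Qᵀ *ᵥ v) ⬝ᵥ (Qᵀ *ᵥ v) = (R *ᵥ v) ⬝ᵥ D.ΘStar⁻¹ *ᵥ (R *ᵥ v) := by
        rw [hQt, ← mulVec_mulVec, ← hSS, Matrix.mul_inv_rev, ← mulVec_mulVec _ S⁻¹ S⁻¹,
          dotProduct_mulVec_eq_transpose S⁻¹ (R *ᵥ v), hSi]
      rw [sub_mulVec, dotProduct_sub, e1, e2]
    have h3 : (Qᵀ *ᵥ v) ⬝ᵥ (Qᵀ *ᵥ v) ≤ v ⬝ᵥ v := by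
      have e1 := dotProduct_mulVec_self_le Qᵀ v
      rw [specNorm_transpose] at e1
      have e2 : specNorm Q ^ 2 ≤ 1 := pow_le_one₀ (specNorm_nonneg _) hQ1
      have e3 := dotProduct_self_nonneg' v
      nlinarith
    have h4 : (R *ᵥ g) ⬝ᵥ v = v ⬝ᵥ v - v ⬝ᵥ A *ᵥ v := by
      rw [← hAv, sub_mulVec, one_mulVec, sub_dotProduct, dotProduct_comm v (A *ᵥ v)]
    rw [h1, h2]
    linarith
  have hsup := D.le_supportZ hu (D.liftedForm h H)
  rw [trace_vecMulVec_mul_eq, dotProduct_liftedForm D u h H, ← hg] at hsup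
  -- The comparison of determinants yields the constant `δ / (1 - ‖Ĥ‖)`, which is no larger than the
  -- one in `Φ`, with excess proportional to `δ²`.
  have hfrob : D.δ / (1 - specNorm (D.conj H)) * frobSq (D.conj H) ≤
      D.δ * (2 + D.δ) / (2 * (1 - specNorm (D.conj H))) * frobSq (D.conj H) := by
    refine mul_le_mul_of_nonneg_right ?_ (frobSq_nonneg _)
    have h1 : 0 < 1 - specNorm (D.conj H) := by linarith
    rw [div_le_div_iff₀ h1 (by linarith)]
    nlinarith [D.δ_nonneg, mul_nonneg (mul_nonneg D.δ_nonneg D.δ_nonneg) h1.le]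
  have hhalf : 2 * D.δ / (1 - specNorm (D.conj H)) * frobSq (D.conj H) =
      2 * (D.δ / (1 - specNorm (D.conj H)) * frobSq (D.conj H)) := by ring
  rw [Phi]
  linarith

theorem zero_mem_detectors : (0, 0) ∈ D.detectors := by
  have h : (D.β • D.ΘStar⁻¹).PosSemidef := D.posSemidef_ΘStar.inv.smul D.β_nonneg
  exact ⟨isSymm_zero, by simpa using h, by simpa using h⟩

theorem Phi_zero (Θ : Matrix (Fin d) (Fin d) ℝ) : D.Phi 0 0 Θ = 0 := by
  have hrow : replicateRow Unit (0 : Fin d → ℝ) = 0 := rfl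
  have hcol : replicateCol Unit (0 : Fin d → ℝ) = 0 := rfl
  have h1 : D.liftedForm 0 0 = 0 := by
    rw [liftedForm, hrow, hcol, fromBlocks_zero]
    simp
  have h2 : D.supportZ 0 = 0 := by
    simp [supportZ, D.nonempty_Z.image_const]
  simp [Phi, h1, h2, conj, frobSq]

/-- Needed because the moment of `-φ*` under `𝒢₀` involves the pair `(-h, -H)`. -/
theorem neg_mem_detectors {p : (Fin d → ℝ) × Matrix (Fin d) (Fin d) ℝ} (hp : p ∈ D.detectors) :
    -p ∈ D.detectors := by
  obtain ⟨hs, hlo, hup⟩ := hp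
  refine ⟨?_, ?_, ?_⟩
  · rw [IsSymm, Prod.snd_neg, transpose_neg, hs.eq]
  · rw [Prod.snd_neg, neg_sub_neg]; exact hup
  · rw [Prod.snd_neg, sub_neg_eq_add, add_comm]; rwa [sub_neg_eq_add] at hlo

theorem continuous_Phi (h : Fin d → ℝ) (H : Matrix (Fin d) (Fin d) ℝ) :
    Continuous fun Θ => D.Phi h H Θ := by
  have : Continuous fun Θ : Matrix (Fin d) (Fin d) ℝ => ((Θ - D.ΘStar) * H).trace :=
    ((continuous_id.sub continuous_const).matrix_mul continuous_const).matrix_trace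
  unfold Phi
  fun_prop

end UncertaintyData

/-! ### The detector at a saddle point -/

section SaddlePoint

variable {d : ℕ} {D₀ D₁ : UncertaintyData d} {p : (Fin d → ℝ) × Matrix (Fin d) (Fin d) ℝ}
  {q : Matrix (Fin d) (Fin d) ℝ × Matrix (Fin d) (Fin d) ℝ}

/-- Only minimality in the detector is used: for every competitor the value at `q` is at least the
saddle objective and at most the supremum over the covariances. Compactness and continuity ensure
that this is a supremum of a bounded set. -/
theorem IsSaddle.objective_le_saddleValue (hs : IsSaddle D₀ D₁ p q) :
    objective D₀ D₁ p q ≤ saddleValue D₀ D₁ := by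
  obtain ⟨hp, hq, hsaddle⟩ := hs
  refine le_csInf ⟨_, Set.mem_image_of_mem _ hp⟩ ?_
  rintro _ ⟨p', hp', rfl⟩
  have hcont : Continuous (objective D₀ D₁ p') := by
    unfold objective
    exact continuous_const.mul (((D₀.continuous_Phi _ _).comp continuous_fst).add
      ((D₁.continuous_Phi _ _).comp continuous_snd))
  exact (hsaddle p' hp' q hq).trans (le_csSup
    ((D₀.isCompact_U.prod D₁.isCompact_U).image hcont).bddAbove (Set.mem_image_of_mem _ hq))

/-- The zero detector is admissible on both sides and has value `0`. -/
theorem IsSaddle.objective_nonpos (hs : IsSaddle D₀ D₁ p q) : objective D₀ D₁ p q ≤ 0 := by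
  obtain ⟨hp, hq, hsaddle⟩ := hs
  have h := hsaddle (0, 0) ⟨D₀.zero_mem_detectors, D₁.zero_mem_detectors⟩ q hq
  simpa [objective, UncertaintyData.Phi_zero] using h

theorem measurable_detector : Measurable (detector D₀ D₁ p q) := by
  unfold detector
  simp only [dotProduct, mulVec]
  fun_prop

/-- Maximality of `Θ₀*` lets `Φ₀` at the saddle point bound the moment for every `Θ ∈ 𝒰₀`. The
additive constant of `φ*` balances the two sides: `Φ₀ - c` and `Φ₁ + c` both equal the objective. -/
theorem IsSaddle.lintegral_exp_neg_detector_le (hs : IsSaddle D₀ D₁ p q)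
    {ν : ProbabilityMeasure (EuclideanSpace ℝ (Fin d))} (hν : ν ∈ D₀.gaussians) :
    ∫⁻ x, ENNReal.ofReal (Real.exp (-detector D₀ D₁ p q x))
        ∂(ν : Measure (EuclideanSpace ℝ (Fin d))) ≤
      ENNReal.ofReal (Real.exp (objective D₀ D₁ p q)) := by
  obtain ⟨hp, hq, hsaddle⟩ := hs
  obtain ⟨u, Θ, hΘ, hu, hνeq⟩ := hν
  have hmax := hsaddle p hp (Θ, q.2) ⟨hΘ, hq.2⟩
  have hmgf := UncertaintyData.lintegral_exp_quadratic_le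
    (UncertaintyData.neg_mem_detectors hp.1) hΘ hu
  set c := 1 / 2 * (D₀.Phi (-p.1) (-p.2) q.1 - D₁.Phi p.1 p.2 q.2) with hc
  have hpt : ∀ x : EuclideanSpace ℝ (Fin d), ENNReal.ofReal (Real.exp (-detector D₀ D₁ p q x)) =
      ENNReal.ofReal (Real.exp (-c)) * ENNReal.ofReal (Real.exp
        (1 / 2 * (x.ofLp ⬝ᵥ (-p).2 *ᵥ x.ofLp) + (-p).1 ⬝ᵥ x.ofLp)) := by
    intro x
    rw [← ENNReal.ofReal_mul (Real.exp_pos _).le, ← Real.exp_add, detector, ← hc, Prod.snd_neg,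
      Prod.fst_neg, neg_mulVec, dotProduct_neg, neg_dotProduct]
    congr 2
    ring
  rw [lintegral_congr hpt, lintegral_const_mul' _ _ ENNReal.ofReal_ne_top, hνeq]
  refine (mul_le_mul_right hmgf _).trans ?_
  rw [← ENNReal.ofReal_mul (Real.exp_pos _).le, ← Real.exp_add]
  refine ENNReal.ofReal_le_ofReal (Real.exp_le_exp.2 ?_)
  simp only [objective, Prod.fst_neg, Prod.snd_neg] at hmax ⊢
  linarith

theorem IsSaddle.lintegral_exp_detector_le (hs : IsSaddle D₀ D₁ p q)
    {ν : ProbabilityMeasure (EuclideanSpace ℝ (Fin d))} (hν : ν ∈ D₁.gaussians) :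
    ∫⁻ x, ENNReal.ofReal (Real.exp (detector D₀ D₁ p q x))
        ∂(ν : Measure (EuclideanSpace ℝ (Fin d))) ≤
      ENNReal.ofReal (Real.exp (objective D₀ D₁ p q)) := by
  obtain ⟨hp, hq, hsaddle⟩ := hs
  obtain ⟨u, Θ, hΘ, hu, hνeq⟩ := hν
  have hmax := hsaddle p hp (q.1, Θ) ⟨hq.1, hΘ⟩
  have hmgf := UncertaintyData.lintegral_exp_quadratic_le hp.2 hΘ hu
  set c := 1 / 2 * (D₀.Phi (-p.1) (-p.2) q.1 - D₁.Phi p.1 p.2 q.2) with hc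
  have hpt : ∀ x : EuclideanSpace ℝ (Fin d), ENNReal.ofReal (Real.exp (detector D₀ D₁ p q x)) =
      ENNReal.ofReal (Real.exp c) * ENNReal.ofReal (Real.exp
        (1 / 2 * (x.ofLp ⬝ᵥ p.2 *ᵥ x.ofLp) + p.1 ⬝ᵥ x.ofLp)) := by
    intro x
    rw [← ENNReal.ofReal_mul (Real.exp_pos _).le, ← Real.exp_add, detector, ← hc, add_comm c]
  rw [lintegral_congr hpt, lintegral_const_mul' _ _ ENNReal.ofReal_ne_top, hνeq]
  refine (mul_le_mul_right hmgf _).trans ?_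
  rw [← ENNReal.ofReal_mul (Real.exp_pos _).le, ← Real.exp_add]
  refine ENNReal.ofReal_le_ofReal (Real.exp_le_exp.2 ?_)
  simp only [objective] at hmax ⊢
  linarith

end SaddlePoint

end RobustCusum

/-! ### The corollary -/

open RobustCusum MeasureTheory Filter Topology in
theorem corollary2 {d : ℕ} (D₀ D₁ : UncertaintyData d)
    (p : (Fin d → ℝ) × Matrix (Fin d) (Fin d) ℝ)
    (q : Matrix (Fin d) (Fin d) ℝ × Matrix (Fin d) (Fin d) ℝ)
    (hsaddle : IsSaddle D₀ D₁ p q) :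
    (∀ ν₀ ∈ D₀.gaussians, ∀ ν₁ ∈ D₁.gaussians,
      ∃ η : ℝ → ℝ, Tendsto η atTop (𝓝 0) ∧
        ∀ᶠ b : ℝ in atTop,
          WDD ν₀ ν₁ (T2 D₀ D₁ p q b) ≤
            ENNReal.ofReal b / ENNReal.ofReal (1 - epsStar D₀ D₁) * ENNReal.ofReal (1 + η b)) ∧
    (∃ thr : ℝ → ℝ,
      (∀ ν₀ ∈ D₀.gaussians, ∀ γ : ℝ, ENNReal.ofReal γ ≤ ARL ν₀ (T2 D₀ D₁ p q (thr γ))) ∧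
      ∀ ν₀ ∈ D₀.gaussians, ∀ ν₁ ∈ D₁.gaussians,
        ∃ η : ℝ → ℝ, Tendsto η atTop (𝓝 0) ∧
          ∀ᶠ γ : ℝ in atTop,
            WDD ν₀ ν₁ (T2 D₀ D₁ p q (thr γ)) ≤
              ENNReal.ofReal (Real.log γ) / ENNReal.ofReal (1 - epsStar D₀ D₁) *
                ENNReal.ofReal (1 + η γ)) := by
  have hscore : Measurable fun ξ => -detector D₀ D₁ p q ξ := measurable_detector.neg
  have hdelay : ∀ ν₀ ∈ D₀.gaussians, ∀ ν₁ ∈ D₁.gaussians,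
      ∃ η : ℝ → ℝ, Tendsto η atTop (𝓝 0) ∧ ∀ᶠ b : ℝ in atTop,
        WDD ν₀ ν₁ (T2 D₀ D₁ p q b) ≤
          ENNReal.ofReal b / ENNReal.ofReal (1 - epsStar D₀ D₁) * ENNReal.ofReal (1 + η b) := by
    intro ν₀ _ ν₁ hν₁
    refine exists_WDD_cusumTime_le ν₀ ν₁ hscore (Real.exp_pos _).le ?_
    simp only [neg_neg]
    exact (hsaddle.lintegral_exp_detector_le hν₁).trans
      (ENNReal.ofReal_le_ofReal (Real.exp_le_exp.2 hsaddle.objective_le_saddleValue))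
  -- The threshold `log γ` turns the bound `exp b` for the run length into `γ`, and the delay
  -- estimate is composed with `log γ → ∞`.
  refine ⟨hdelay, Real.log, fun ν₀ hν₀ γ => ?_, fun ν₀ hν₀ ν₁ hν₁ => ?_⟩
  -- For `γ ≤ 0` the requirement is void, whatever the default value of the logarithm.
  · rcases le_or_gt γ 0 with hγ | hγ
    · simp [ENNReal.ofReal_of_nonpos hγ]
    · have h := exp_le_ARL_cusumTime ν₀ hscore ((hsaddle.lintegral_exp_neg_detector_le hν₀).trans
        (ENNReal.ofReal_le_one.2 (Real.exp_le_one_iff.2 hsaddle.objective_nonpos))) (Real.log γ)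
      rwa [Real.exp_log hγ] at h
  · obtain ⟨η, hη, hle⟩ := hdelay ν₀ hν₀ ν₁ hν₁
    exact ⟨η ∘ Real.log, hη.comp Real.tendsto_log_atTop, Real.tendsto_log_atTop.eventually hle⟩
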